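/- Let $\Phi$ be a reduced crystallographic (finite) root system spanning the rational vector space $\mathfrak h^*_{\mathbb Q}$ (for instance, the root system of a simply-connected complex semisimple group), let $\mathfrak h_{\mathbb Q}$ be the dual space, $\Delta$ a base of simple roots, $\Phi^+$ the positive roots, $W$ the Weyl group, $\ell$ the length function with respect to the simple reflections, and $w_0\in W$ the longest element. Let $R=\mathrm{Sym}^\bullet(\mathfrak h^*_{\mathbb Q})$, regarded as the ring of polynomial functions on $\mathfrak h_{\mathbb Q}$, with the induced action of $W$, and let $J\subset R$ be the ideal generated by the $W$-invariant polynomials with zero constant term. For a root $\gamma$ with reflection $\sigma_\gamma$ let $A_\gamma(f)=(f-\sigma_\gamma f)/\gamma\in R$. For each $v\in W$ fix a reduced decomposition $v=\sigma_{\gamma_1}\cdots\sigma_{\gamma_t}$ into simple reflections and put $A_v=A_{\gamma_1}\circ\cdots\circ A_{\gamma_t}$. Put $$\tilde P_{w_0}=\frac1{|W|}\prod_{\alpha\in\Phi^+}\alpha,\qquad \tilde P_w=A_{w^{-1}w_0}\tilde P_{w_0}\quad(w\in W),$$ and let $P_w$ be the image of $\tilde P_w$ in $R/J$. Then, for every choice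 of the reduced decompositions, the following hold. (1) For every $f\in R$ there is exactly one $D(f)\in R$ with $$\Big(\prod_{\alpha\in\Phi^+}\alpha\Big)\,D(f)=\sum_{\sigma\in W}(-1)^{\ell(\sigma)}\sigma(f),$$ and $D:R\to R$ is $\mathbb Q$-linear. Hence $$\Psi(f)=\frac{1}{\prod_{\alpha\in \Phi^+}\alpha}\sum_{\sigma\in W}(-1)^{\ell(\sigma)}\sigma(f)\,\Big|_{0}:=D(f)(0)$$ is a well-defined linear functional $\Psi:R\to\mathbb Q$. (2) The classes $P_w$ $(w\in W)$ form a $\mathbb Q$-basis of $R/J$, and for every $f\in R$ the number $\Psi(f)$ is the coefficient of $P_{w_0}$ in the expansion of the class $\bar f\in R/J$ in this basis. (3) If $f\in R$ has degree at most $|\Phi^+|=\deg\tilde P_{w_0}$, then $\Psi(f)=D(f)(h)$ for every $h\in\mathfrak h_{\mathbb Q}$. -/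

import Mathlib

noncomputable section

namespace BGG

open RootPairing

variable {ι M N : Type*} [AddCommGroup M] [Module ℚ M] [AddCommGroup N] [Module ℚ N]

/-! ### The Weyl group, simple reflections and length -/

section Weyl

variable {P : RootPairing ι ℚ M N} (b : P.Base)

/-- The simple reflection attached to a simple root. -/
def simpleRefl (i : b.support) : P.weylGroup := weylGroup.ofIdx P i

/-- The product of a word in the simple reflections. -/
def wordProd (l : List b.support) : P.weylGroup := (l.map (simpleRefl b)).prod

/-- The length `ℓ(w)`: the least length of a word in the simple reflections with product `w`. -/
def length (w : P.weylGroup) : ℕ := sInf {n | ∃ l : List b.support, l.length = n ∧ wordProd b l = w}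

/-- A reduced word of `w`: a word in the simple reflections of minimal length with product `w`. -/
def IsReducedWord (w : P.weylGroup) (l : List b.support) : Prop :=
  wordProd b l = w ∧ l.length = length b w

lemma exists_word [Finite ι] [P.IsCrystallographic] [P.IsReduced] [P.IsRootSystem]
    (w : P.weylGroup) : ∃ l : List b.support, wordProd b l = w := by
  have key : ∀ i : ι, Equiv.reflection P i ∈
      Submonoid.closure (Set.range fun j : b.support ↦ Equiv.reflection P j) := by
    intro i
    refine b.induction_reflect i (p := fun i ↦ Equiv.reflection P i ∈
      Submonoid.closure (Set.range fun j : b.support ↦ Equiv.reflection P j)) ?_ ?_ ?_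
    · intro i hi
      have : Equiv.reflection P (P.reflectionPerm i i) = Equiv.reflection P i := by
        apply Equiv.weightHom_injective P
        simp only [Equiv.weightHom_apply, Equiv.reflection_weightEquiv]
        rw [reflection_reflectionPerm]
        ext x; simp
      rwa [this]
    · exact fun i hi ↦ Submonoid.subset_closure ⟨⟨i, hi⟩, rfl⟩
    · intro i j hi hj
      have hj' := Submonoid.subset_closure
        (s := Set.range fun j : b.support ↦ Equiv.reflection P j) ⟨⟨j, hj⟩, rfl⟩
      have : Equiv.reflection P (P.reflectionPerm j i) =
          Equiv.reflection P j * Equiv.reflection P i * Equiv.reflection P j := by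
        apply Equiv.weightHom_injective P
        simp only [map_mul, Equiv.weightHom_apply, Equiv.reflection_weightEquiv]
        rw [reflection_reflectionPerm]
      rw [this]
      exact mul_mem (mul_mem hj' hi) hj'
  obtain ⟨w, hw⟩ := w
  have hw' : w ∈ Submonoid.closure (Set.range fun j : b.support ↦ Equiv.reflection P j) := by
    rw [← Subgroup.mem_toSubmonoid, weylGroup_toSubmonoid] at hw
    refine Submonoid.closure_le.2 ?_ hw
    rintro _ ⟨i, rfl⟩
    exact key i
  have hword : ∃ l : List b.support, (l.map fun j : b.support ↦ Equiv.reflection P (j : ι)).prod = w := by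
    clear hw
    induction hw' using Submonoid.closure_induction with
    | mem x hx =>
      obtain ⟨j, rfl⟩ := hx
      exact ⟨[j], by simp⟩
    | one => exact ⟨[], rfl⟩
    | mul x y _ _ hx hy =>
      obtain ⟨l, rfl⟩ := hx
      obtain ⟨l', rfl⟩ := hy
      exact ⟨l ++ l', by simp⟩
  obtain ⟨l, hl⟩ := hword
  refine ⟨l, Subtype.ext ?_⟩
  rw [wordProd, ← Subgroup.coe_subtype, map_list_prod, List.map_map]
  exact hl

/-- Every element of the Weyl group has a reduced word. -/
lemma exists_isReducedWord [Finite ι] [P.IsCrystallographic] [P.IsReduced] [P.IsRootSystem]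
    (w : P.weylGroup) : ∃ l : List b.support, IsReducedWord b w l := by
  obtain ⟨l, hl⟩ := exists_word b w
  obtain ⟨l', h1, h2⟩ := Nat.sInf_mem
    (s := {n | ∃ l : List b.support, l.length = n ∧ wordProd b l = w}) ⟨_, l, rfl, hl⟩
  exact ⟨l', h2, h1⟩

end Weyl

instance finite_weylGroup (P : RootPairing ι ℚ M N) [Finite ι] [P.IsRootSystem] :
    Finite P.weylGroup := by
  have h : Function.Injective (Equiv.indexHom P) := by
    intro g g' hgg'
    apply Equiv.weightHom_injective P
    have hroot : ∀ i, Equiv.weightHom P g (P.root i) = Equiv.weightHom P g' (P.root i) := by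
      intro i
      have h1 := Equiv.root_indexEquiv_eq_smul (P := P) i g
      have h2 := Equiv.root_indexEquiv_eq_smul (P := P) i g'
      have h3 : g.indexEquiv i = g'.indexEquiv i := congrArg (fun e : ι ≃ ι ↦ e i) hgg'
      rw [h3, h2] at h1
      exact h1.symm
    apply LinearEquiv.toLinearMap_injective
    exact LinearMap.ext_on_range (IsRootSystem.span_root_eq_top (P := P)) hroot
  have : Finite (Aut P) := Finite.of_injective _ h
  infer_instance

instance fintype_weylGroup (P : RootPairing ι ℚ M N) [Finite ι] [P.IsRootSystem] :
    Fintype P.weylGroup := Fintype.ofFinite _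

/-! ### The polynomial ring `R = Sym(𝔥^*)` -/

section Polynomials

variable (P : RootPairing ι ℚ M N)

/-- The action of a Weyl group element on `Sym(𝔥^*)` by algebra automorphisms, extending its action
on `𝔥^*`. -/
def act (w : P.weylGroup) : SymmetricAlgebra ℚ M →ₐ[ℚ] SymmetricAlgebra ℚ M :=
  SymmetricAlgebra.lift (SymmetricAlgebra.ι ℚ M ∘ₗ P.weylGroupRootRep w)

/-- Evaluation of an element of `Sym(𝔥^*)`, as a polynomial function, at a point of `𝔥`. -/
def evalAt (h : N) : SymmetricAlgebra ℚ M →ₐ[ℚ] ℚ :=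
  SymmetricAlgebra.lift (P.toLinearMap.flip h)

/-- The root with index `i`, as an element of `Sym(𝔥^*)`. -/
def rootElt (i : ι) : SymmetricAlgebra ℚ M := SymmetricAlgebra.ι ℚ M (P.root i)

/-- The ideal `J` generated by the `W`-invariants with zero constant term. -/
def coinvariantIdeal : Ideal (SymmetricAlgebra ℚ M) :=
  Ideal.span {f | (∀ w : P.weylGroup, act P w f = f) ∧ evalAt P 0 f = 0}

/-- The coinvariant algebra `R / J`. -/
abbrev CoinvariantAlgebra : Type _ := SymmetricAlgebra ℚ M ⧸ coinvariantIdeal P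

lemma rootElt_dvd_sub (i : ι) (f : SymmetricAlgebra ℚ M) :
    rootElt P i ∣ f - act P (weylGroup.ofIdx P i) f := by
  induction f using SymmetricAlgebra.induction with
  | algebraMap r => simp
  | ι x =>
    have h : P.weylGroupRootRep (weylGroup.ofIdx P i) x = P.reflection i x := rfl
    refine ⟨algebraMap ℚ _ (P.toLinearMap x (P.coroot i)), ?_⟩
    simp [act, rootElt, h, reflection_apply, mul_comm, Algebra.smul_def]
  | mul a c ha hc =>
    have : a * c - act P (weylGroup.ofIdx P i) (a * c) =
        a * (c - act P (weylGroup.ofIdx P i) c) +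
        (a - act P (weylGroup.ofIdx P i) a) * act P (weylGroup.ofIdx P i) c := by
      rw [map_mul]; ring
    rw [this]
    exact dvd_add (hc.mul_left _) (ha.mul_right _)
  | add a c ha hc =>
    rw [map_add, add_sub_add_comm]
    exact dvd_add ha hc

/-- The divided difference operator `A_γ(f) = (f - σ_γ f) / γ`, for the root `γ` with index `i`. -/
def divDiff (i : ι) (f : SymmetricAlgebra ℚ M) : SymmetricAlgebra ℚ M :=
  Classical.choose (rootElt_dvd_sub P i f)

/-- This determines `divDiff P i f`, since `Sym(𝔥^*)` is a domain and roots are nonzero. -/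
lemma rootElt_mul_divDiff (i : ι) (f : SymmetricAlgebra ℚ M) :
    rootElt P i * divDiff P i f = f - act P (weylGroup.ofIdx P i) f :=
  (Classical.choose_spec (rootElt_dvd_sub P i f)).symm

variable (M) in
/-- Elements of `Sym(𝔥^*)` of degree at most `n`: the span of the products of at most `n` elements
of `𝔥^*`. -/
def degreeLE (n : ℕ) : Submodule ℚ (SymmetricAlgebra ℚ M) :=
  (1 ⊔ LinearMap.range (SymmetricAlgebra.ι ℚ M)) ^ n

end Polynomials

section Schubert

variable {P : RootPairing ι ℚ M N} (b : P.Base)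

/-- `A_{γ₁} ∘ ⋯ ∘ A_{γ_t}` for a word `γ₁, …, γ_t` in the simple roots. -/
def divDiffWord (l : List b.support) (f : SymmetricAlgebra ℚ M) : SymmetricAlgebra ℚ M :=
  l.foldr (fun i g ↦ divDiff P i g) f

variable [Fintype ι] [P.IsCrystallographic] [P.IsReduced] [P.IsRootSystem]

open scoped Classical in
/-- The (indices of) positive roots. -/
def posRoots : Finset ι := Finset.univ.filter fun i ↦ b.IsPos i

/-- The product of the positive roots, in `Sym(𝔥^*)`. -/
def posRootProd : SymmetricAlgebra ℚ M := ∏ i ∈ posRoots b, rootElt P i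

/-- The alternating sum `∑_σ (-1)^{ℓ(σ)} σ(f)` over the Weyl group. -/
def altSum (f : SymmetricAlgebra ℚ M) : SymmetricAlgebra ℚ M :=
  ∑ w : P.weylGroup, (-1) ^ length b w * act P w f

/-- `P̃_{w₀} = (1 / |W|) ∏ α`, the product over the positive roots. -/
def topPoly : SymmetricAlgebra ℚ M := (1 / (Nat.card P.weylGroup : ℚ)) • posRootProd b

/-- `P̃_w = A_{w⁻¹w₀} P̃_{w₀}`, where `A_v` is computed from the word `word v` of `v`. -/
def schubertPoly (w₀ : P.weylGroup) (word : P.weylGroup → List b.support) (w : P.weylGroup) :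
    SymmetricAlgebra ℚ M :=
  divDiffWord b (word (w⁻¹ * w₀)) (topPoly b)

end Schubert

end BGG

end

noncomputable section

set_option linter.unusedSectionVars false

namespace BGG

open RootPairing

variable {ι M N : Type*} [AddCommGroup M] [Module ℚ M] [AddCommGroup N] [Module ℚ N]

/-! ### The action of the Weyl group on roots -/

section Action

variable (P : RootPairing ι ℚ M N)

/-! Write `σ_i`, `A_i` for the simple reflections and their divided differences. The alternating sum
of `f` changes sign under every reflection, so every positive root divides it; distinct positive
roots are not proportional, so their product divides it too. As `R` is a domain, the quotient `D(f)`
is unique. `D` is linear over the invariants and hence preserves `J`; it kills the image of every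
`A_i`, and it sends the top polynomial to `1`.

For the basis, map `f` to the vector of the values `(A_v f)(0)`, `v ∈ W`. Its kernel is exactly `J`
(`evalVec_eq_zero_iff`): the `A_v` preserve `J`, and conversely induction on the degree shows that
`f` is congruent modulo `J` to its average over `W`. On the Schubert polynomials the vectors are
triangular with respect to length, because a product of words is killed unless it is reduced; every
diagonal entry is the constant `c = A_{w₀} P̃_{w₀}`. Once `c ≠ 0`, the `|W|` vectors are independent
in a space of dimension `|W|`, so the classes form a basis. Applying `D` to an expansion modulo `J`
and evaluating at `0` leaves only the coefficient of `P_{w₀}`.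

Two facts about the operators carry this. First, `A_v` depends only on `v` and vanishes for
nonreduced words (`divDiffWord_eq_divDiffOfLength`); instead of braid relations, the proof uses the
commutation rule of `A_v` with linear forms. Second, `A_v ≠ 0` (`exists_divDiffWord_ne_zero`), by
Dedekind's independence of automorphisms. Since `A_{w₀} = c D`, the second fact gives `c ≠ 0`; and
since `A_{w₀}` lowers degrees by `|Φ⁺|`, `D(f)` is constant in degree at most `|Φ⁺|`, which is the
last claim. -/

/-- The action of the Weyl group on the indices of the roots. -/
def perm : P.weylGroup →* Equiv.Perm ι := (Equiv.indexHom P).comp P.weylGroup.subtype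

variable {P}

lemma root_perm (w : P.weylGroup) (i : ι) :
    P.root (perm P w i) = P.weylGroupRootRep w (P.root i) :=
  Equiv.root_indexEquiv_eq_smul (P := P) i w.1

lemma rootRep_ofIdx (i : ι) (x : M) :
    P.weylGroupRootRep (weylGroup.ofIdx P i) x = P.reflection i x := rfl

lemma rootRep_injective : Function.Injective P.weylGroupRootRep := by
  intro u v h
  apply Subtype.ext
  apply Equiv.weightHom_injective P
  apply LinearEquiv.toLinearMap_injective
  exact h

lemma perm_ofIdx (i j : ι) : perm P (weylGroup.ofIdx P i) j = P.reflectionPerm i j := by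
  apply P.root.injective
  rw [root_perm, rootRep_ofIdx, root_reflectionPerm]

lemma root_reflectionPerm_self (i : ι) : P.root (P.reflectionPerm i i) = -P.root i := by
  rw [root_reflectionPerm, reflection_apply_self]

lemma ofIdx_mul_self (i : ι) : weylGroup.ofIdx P i * weylGroup.ofIdx P i = 1 := by
  apply rootRep_injective
  ext x
  rw [map_mul, map_one]
  simp [rootRep_ofIdx]

lemma ofIdx_mul_cancel_left (i : ι) (w : P.weylGroup) :
    weylGroup.ofIdx P i * (weylGroup.ofIdx P i * w) = w := by
  rw [← mul_assoc, ofIdx_mul_self, one_mul]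

lemma ofIdx_inv (i : ι) : (weylGroup.ofIdx P i)⁻¹ = weylGroup.ofIdx P i :=
  inv_eq_of_mul_eq_one_left (ofIdx_mul_self i)

lemma perm_reflectionPerm_self (w : P.weylGroup) (i : ι) :
    perm P w (P.reflectionPerm i i) = P.reflectionPerm (perm P w i) (perm P w i) := by
  apply P.root.injective
  rw [root_perm, root_reflectionPerm_self, root_reflectionPerm_self, map_neg, root_perm]

lemma pairing_rootRep (w : P.weylGroup) (x : M) (i : ι) :
    P.toLinearMap (P.weylGroupRootRep w x) (P.coroot (perm P w i)) =
      P.toLinearMap x (P.coroot i) := by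
  have h := LinearMap.congr_fun
    (Hom.weight_coweight_transpose_apply P P (P.coroot (perm P w i)) w.1.toHom) x
  rw [Hom.coroot_coweightMap_apply] at h
  have h' : w.1.toHom.indexEquiv.symm (perm P w i) = i := w.1.toHom.indexEquiv.symm_apply_apply i
  rw [h'] at h
  exact h

lemma ofIdx_perm (w : P.weylGroup) (i : ι) :
    weylGroup.ofIdx P (perm P w i) = w * weylGroup.ofIdx P i * w⁻¹ := by
  apply rootRep_injective
  rw [map_mul, map_mul]
  ext x
  obtain ⟨y, rfl⟩ : ∃ y, P.weylGroupRootRep w y = x :=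
    ⟨P.weylGroupRootRep w⁻¹ x, by
      rw [← Module.End.mul_apply, ← map_mul, mul_inv_cancel, map_one, Module.End.one_apply]⟩
  have h : P.weylGroupRootRep w⁻¹ (P.weylGroupRootRep w y) = y := by
    rw [← Module.End.mul_apply, ← map_mul, inv_mul_cancel, map_one, Module.End.one_apply]
  rw [Module.End.mul_apply, Module.End.mul_apply, h, rootRep_ofIdx, rootRep_ofIdx,
    reflection_apply, reflection_apply, map_sub, map_smul, root_perm]
  congr 2
  exact pairing_rootRep w y i

lemma ofIdx_reflectionPerm_self (i : ι) :
    weylGroup.ofIdx P (P.reflectionPerm i i) = weylGroup.ofIdx P i := by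
  rw [← perm_ofIdx, ofIdx_perm, ofIdx_mul_self, one_mul, ofIdx_inv]

end Action

/-! ### Inversions, exchange and length -/

section Length

variable {P : RootPairing ι ℚ M N} (b : P.Base)

lemma isPos_reflectionPerm_self_iff (i : ι) :
    b.IsPos (P.reflectionPerm i i) ↔ ¬ b.IsPos i :=
  Base.IsPos.neg_iff_not b i

lemma wordProd_cons (i : b.support) (l : List b.support) :
    wordProd b (i :: l) = weylGroup.ofIdx P i * wordProd b l := by
  simp [wordProd, simpleRefl]

lemma wordProd_append (l l' : List b.support) :
    wordProd b (l ++ l') = wordProd b l * wordProd b l' := by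
  simp [wordProd]

lemma wordProd_reverse (l : List b.support) : wordProd b l.reverse = (wordProd b l)⁻¹ := by
  induction l with
  | nil => simp [wordProd]
  | cons i l ih =>
    rw [List.reverse_cons, wordProd_append, ih, wordProd_cons, wordProd_cons, mul_inv_rev,
      ofIdx_inv]
    simp [wordProd]

lemma length_wordProd_le (l : List b.support) : length b (wordProd b l) ≤ l.length :=
  Nat.sInf_le ⟨l, rfl, rfl⟩

variable [Fintype ι] [P.IsCrystallographic] [P.IsReduced] [P.IsRootSystem]

open scoped Classical in
/-- The positive roots made negative by `w`. -/
def inversions (w : P.weylGroup) : Finset ι :=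
  Finset.univ.filter fun i ↦ b.IsPos i ∧ ¬ b.IsPos (perm P w i)

variable {b}

lemma mem_inversions {w : P.weylGroup} {i : ι} :
    i ∈ inversions b w ↔ b.IsPos i ∧ ¬ b.IsPos (perm P w i) := by
  simp [inversions]

lemma isPos_ofIdx_iff {i j : ι} (hi : i ∈ b.support) (hij : j ≠ i)
    (hij' : j ≠ P.reflectionPerm i i) :
    b.IsPos (perm P (weylGroup.ofIdx P i) j) ↔ b.IsPos j := by
  rw [perm_ofIdx]
  refine ⟨fun h ↦ ?_, fun h ↦ h.reflectionPerm hi hij⟩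
  have := h.reflectionPerm hi (fun h' ↦ hij' (by rw [← (P.reflectionPerm_involutive i).eq_iff, h']))
  rwa [reflectionPerm_self] at this

/-- Let the letters act on `γ` from the right. At the letter that first makes it negative, the
current root must be that simple root itself, and this letter can be deleted. -/
lemma exchange (l : List b.support) {γ : ι} (hγ : γ ∈ inversions b (wordProd b l)) :
    ∃ l' : List b.support, l'.length + 1 = l.length ∧
      wordProd b l' = wordProd b l * weylGroup.ofIdx P γ := by
  induction l with
  | nil => simp [wordProd, mem_inversions] at hγ
  | cons i l ih =>
    rw [mem_inversions, wordProd_cons, map_mul, Equiv.Perm.mul_apply] at hγ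
    by_cases h : b.IsPos (perm P (wordProd b l) γ)
    · refine ⟨l, rfl, ?_⟩
      have h1 : perm P (wordProd b l) γ = i := by
        by_contra hne
        refine hγ.2 ?_
        rw [perm_ofIdx]
        exact h.reflectionPerm i.2 hne
      rw [wordProd_cons, ← h1, ofIdx_perm]
      simp [mul_assoc, ofIdx_mul_self]
    · obtain ⟨l', h1, h2⟩ := ih (mem_inversions.2 ⟨hγ.1, h⟩)
      exact ⟨i :: l', by simp [h1], by rw [wordProd_cons, wordProd_cons, h2, mul_assoc]⟩

lemma length_mul_ofIdx_lt {w : P.weylGroup} {γ : ι} (hγ : γ ∈ inversions b w) :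
    length b (w * weylGroup.ofIdx P γ) + 1 ≤ length b w := by
  obtain ⟨l, rfl, hl⟩ := exists_isReducedWord b w
  obtain ⟨l', h1, h2⟩ := exchange l hγ
  rw [← h2, ← hl, ← h1]
  exact Nat.succ_le_succ (length_wordProd_le b l')

lemma length_ofIdx_mul_le (i : b.support) (w : P.weylGroup) :
    length b (weylGroup.ofIdx P i * w) ≤ length b w + 1 := by
  obtain ⟨l, rfl, hl⟩ := exists_isReducedWord b w
  rw [← wordProd_cons, ← hl]
  exact length_wordProd_le b (i :: l)

lemma IsReducedWord.tail {i : b.support} {l : List b.support}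
    (h : IsReducedWord b (wordProd b (i :: l)) (i :: l)) : IsReducedWord b (wordProd b l) l := by
  refine ⟨rfl, le_antisymm ?_ (length_wordProd_le b l)⟩
  have := length_ofIdx_mul_le i (wordProd b l)
  rw [← wordProd_cons, ← h.2, List.length_cons] at this
  omega

/-- Otherwise the negative of this root is an inversion of the tail, and exchange yields a word for
the whole product that is shorter than the tail. -/
lemma IsReducedWord.isPos {i : b.support} {l : List b.support}
    (h : IsReducedWord b (wordProd b (i :: l)) (i :: l)) :
    b.IsPos (perm P (wordProd b l)⁻¹ i) := by
  by_contra hneg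
  have hi := Base.isPos_of_mem_support i.2
  set γ := perm P (wordProd b l)⁻¹ i with hγ
  have h1 : perm P (wordProd b l) γ = i := by
    rw [hγ, ← Equiv.Perm.mul_apply, ← map_mul]; simp
  have hmem : P.reflectionPerm γ γ ∈ inversions b (wordProd b l) := by
    rw [mem_inversions, perm_reflectionPerm_self, isPos_reflectionPerm_self_iff,
      isPos_reflectionPerm_self_iff, h1]
    exact ⟨hneg, not_not.2 hi⟩
  obtain ⟨l', h2, h3⟩ := exchange l hmem
  have h4 := length_wordProd_le b l'
  have h5 : wordProd b l' = wordProd b (i :: l) := by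
    rw [h3, ofIdx_reflectionPerm_self, wordProd_cons, hγ, ofIdx_perm, inv_inv]
    simp [mul_assoc]
  rw [h5, ← h.2, List.length_cons] at h4
  omega

/-- A simple reflection changes the sign of no root except plus or minus its own, so only the
preimages of these two roots under `w` need attention. -/
lemma inversions_ofIdx_mul [DecidableEq ι] {i : b.support} {w : P.weylGroup}
    (h : b.IsPos (perm P w⁻¹ i)) :
    inversions b (weylGroup.ofIdx P i * w) = insert (perm P w⁻¹ i) (inversions b w) := by
  have hi := Base.isPos_of_mem_support i.2
  ext j
  rw [Finset.mem_insert, mem_inversions, mem_inversions, map_mul, Equiv.Perm.mul_apply]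
  have key : j = perm P w⁻¹ i ↔ perm P w j = i := by
    rw [map_inv, Equiv.Perm.eq_inv_iff_eq]
  by_cases h1 : perm P w j = i
  · have h2 := key.2 h1
    rw [h1, perm_ofIdx, isPos_reflectionPerm_self_iff]
    exact iff_of_true ⟨h2 ▸ h, not_not.2 hi⟩ (Or.inl h2)
  by_cases h2 : perm P w j = P.reflectionPerm i i
  · have h3 : j = P.reflectionPerm (perm P w⁻¹ i) (perm P w⁻¹ i) := by
      rw [← perm_reflectionPerm_self, ← h2, ← Equiv.Perm.mul_apply, ← map_mul]; simp
    have h4 : ¬ b.IsPos j := by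
      rw [h3, isPos_reflectionPerm_self_iff]; exact not_not.2 h
    have h5 : j ≠ perm P w⁻¹ i := by rwa [Ne, key]
    exact iff_of_false (fun h ↦ h4 h.1) (fun h ↦ h.elim h5 fun h ↦ h4 h.1)
  · rw [isPos_ofIdx_iff i.2 h1 h2, key]
    simp [h1]

lemma perm_inv_notMem_inversions {i : b.support} {w : P.weylGroup} :
    perm P w⁻¹ i ∉ inversions b w := by
  have hi := Base.isPos_of_mem_support i.2
  rw [mem_inversions, ← Equiv.Perm.mul_apply, ← map_mul]
  simp [hi]

lemma length_eq_card (w : P.weylGroup) : length b w = (inversions b w).card := by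
  classical
  obtain ⟨l, rfl, hl⟩ := exists_isReducedWord b w
  rw [← hl]
  induction l with
  | nil => simp [wordProd, inversions]
  | cons i l ih =>
    have h : IsReducedWord b (wordProd b (i :: l)) (i :: l) := ⟨rfl, hl⟩
    rw [wordProd_cons, inversions_ofIdx_mul h.isPos,
      Finset.card_insert_of_notMem perm_inv_notMem_inversions, ← ih h.tail.2, List.length_cons]

lemma length_ofIdx_mul_of_isPos {i : b.support} {w : P.weylGroup}
    (h : b.IsPos (perm P w⁻¹ i)) :
    length b (weylGroup.ofIdx P i * w) = length b w + 1 := by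
  classical
  rw [length_eq_card, length_eq_card, inversions_ofIdx_mul h,
    Finset.card_insert_of_notMem perm_inv_notMem_inversions]

lemma length_ofIdx_mul_of_not_isPos {i : b.support} {w : P.weylGroup}
    (h : ¬ b.IsPos (perm P w⁻¹ i)) :
    length b (weylGroup.ofIdx P i * w) + 1 = length b w := by
  rw [← length_ofIdx_mul_of_isPos, ofIdx_mul_cancel_left]
  rwa [mul_inv_rev, map_mul, Equiv.Perm.mul_apply, ofIdx_inv, perm_ofIdx,
    perm_reflectionPerm_self, isPos_reflectionPerm_self_iff]

lemma neg_one_pow_length_wordProd {R : Type*} [Ring R] (l : List b.support) :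
    (-1 : R) ^ length b (wordProd b l) = (-1) ^ l.length := by
  induction l with
  | nil =>
    have := length_wordProd_le b []
    rw [List.length_nil, Nat.le_zero] at this
    rw [this, List.length_nil]
  | cons i l ih =>
    rw [wordProd_cons, List.length_cons, pow_succ, ← ih]
    by_cases h : b.IsPos (perm P (wordProd b l)⁻¹ i)
    · rw [length_ofIdx_mul_of_isPos h, pow_succ]
    · rw [← length_ofIdx_mul_of_not_isPos h, pow_succ]; simp

lemma neg_one_pow_length_mul {R : Type*} [Ring R] (u v : P.weylGroup) :
    (-1 : R) ^ length b (u * v) = (-1) ^ length b u * (-1) ^ length b v := by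
  obtain ⟨l, rfl⟩ := exists_word b u
  obtain ⟨l', rfl⟩ := exists_word b v
  rw [← wordProd_append]
  simp_rw [neg_one_pow_length_wordProd]
  rw [List.length_append, pow_add]

lemma length_inv (w : P.weylGroup) : length b w⁻¹ = length b w := by
  have h (w : P.weylGroup) : length b w⁻¹ ≤ length b w := by
    obtain ⟨l, rfl, hl⟩ := exists_isReducedWord b w
    rw [← hl, ← wordProd_reverse, ← List.length_reverse]
    exact length_wordProd_le b _
  exact le_antisymm (h w) (by simpa using h w⁻¹)

lemma length_one : length b (1 : P.weylGroup) = 0 := by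
  simpa [wordProd] using length_wordProd_le b []

lemma length_eq_zero {w : P.weylGroup} : length b w = 0 ↔ w = 1 := by
  refine ⟨fun h ↦ ?_, fun h ↦ h ▸ length_one⟩
  obtain ⟨l, rfl, hl⟩ := exists_isReducedWord b w
  rw [h, List.length_eq_zero_iff] at hl
  simp [hl, wordProd]

lemma neg_one_pow_length_ofIdx {R : Type*} [Ring R] (i : ι) :
    (-1 : R) ^ length b (weylGroup.ofIdx P i) = -1 := by
  refine b.induction_reflect i (p := fun i ↦ (-1 : R) ^ length b (weylGroup.ofIdx P i) = -1)
    (fun i hi ↦ by rwa [ofIdx_reflectionPerm_self]) (fun i hi ↦ ?_) (fun i j hi hj ↦ ?_)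
  · simpa [wordProd, simpleRefl] using neg_one_pow_length_wordProd (R := R) (b := b) [⟨i, hi⟩]
  · rw [← perm_ofIdx, ofIdx_perm, neg_one_pow_length_mul, neg_one_pow_length_mul, length_inv, hi,
      mul_assoc, neg_one_mul, mul_neg, ← pow_add, Even.neg_one_pow ⟨_, rfl⟩]

lemma mem_posRoots {i : ι} : i ∈ posRoots b ↔ b.IsPos i := by
  simp [posRoots]

/-! ### The longest element -/

lemma isPos_perm_of_forall {w : P.weylGroup} (h : ∀ i : b.support, ¬ b.IsPos (perm P w i)) {i : ι}
    (hi : b.IsPos i) : ¬ b.IsPos (perm P w i) := by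
  refine hi.induction_on_add (p := fun i ↦ ¬ b.IsPos (perm P w i)) (fun i hi ↦ h ⟨i, hi⟩) ?_
  intro i j k hk hi hj
  replace hj := h ⟨j, hj⟩
  simp only at hj
  rw [← isPos_reflectionPerm_self_iff] at hi hj ⊢
  refine hi.add hj ?_
  simp only [root_reflectionPerm_self, root_perm, hk, map_add, neg_add]

section Longest

variable {w₀ : P.weylGroup} (hw₀ : ∀ w : P.weylGroup, length b w ≤ length b w₀)
include hw₀

lemma length_longest : length b w₀ = (posRoots b).card := by
  -- Maximality is tested by left multiplication by simple reflections, which detects the signs of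
  -- the `w₀⁻¹ α_i`; hence the passage to the inverse.
  rw [← length_inv, length_eq_card]
  congr 1
  ext i
  rw [mem_inversions, mem_posRoots, and_iff_left_iff_imp]
  refine isPos_perm_of_forall fun i hi ↦ ?_
  have := hw₀ (weylGroup.ofIdx P i * w₀)
  rw [length_ofIdx_mul_of_isPos hi] at this
  omega

lemma inversions_longest : inversions b w₀ = posRoots b := by
  refine Finset.eq_of_subset_of_card_le (fun i hi ↦ ?_) ?_
  · exact mem_posRoots.2 (mem_inversions.1 hi).1
  · rw [← length_longest hw₀, length_eq_card]

/-- Since `w₀` makes every positive root negative, `-w₀` permutes the positive roots. It carries the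
non-inversions of `w w₀` to the inversions of `w`. -/
lemma length_mul_longest (w : P.weylGroup) :
    length b (w * w₀) + length b w = length b w₀ := by
  classical
  have h1 : inversions b (w * w₀) = (posRoots b).filter
      fun i ↦ ¬ b.IsPos (perm P (w * w₀) i) := by
    ext; simp [mem_inversions, mem_posRoots]
  have h2 : (inversions b w).card = ((posRoots b).filter
      fun i ↦ b.IsPos (perm P (w * w₀) i)).card := by
    symm
    refine Finset.card_bij (fun i _ ↦ P.reflectionPerm (perm P w₀ i) (perm P w₀ i)) ?_ ?_ ?_
    · intro i hi
      rw [Finset.mem_filter, ← inversions_longest hw₀, mem_inversions, map_mul,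
        Equiv.Perm.mul_apply] at hi
      rw [mem_inversions, perm_reflectionPerm_self, isPos_reflectionPerm_self_iff,
        isPos_reflectionPerm_self_iff, not_not]
      exact ⟨hi.1.2, hi.2⟩
    · intro i _ j _ h
      apply (perm P w₀).injective
      apply P.root.injective
      have := congrArg P.root h
      rwa [root_reflectionPerm_self, root_reflectionPerm_self, neg_inj] at this
    · intro j hj
      rw [mem_inversions] at hj
      have h3 : perm P w₀ (perm P w₀⁻¹ j) = j := by
        rw [← Equiv.Perm.mul_apply, ← map_mul]; simp
      have h4 : perm P w₀ (P.reflectionPerm (perm P w₀⁻¹ j) (perm P w₀⁻¹ j)) =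
          P.reflectionPerm j j := by rw [perm_reflectionPerm_self, h3]
      refine ⟨P.reflectionPerm (perm P w₀⁻¹ j) (perm P w₀⁻¹ j), ?_, ?_⟩
      · rw [Finset.mem_filter, mem_posRoots, map_mul, Equiv.Perm.mul_apply, h4,
          perm_reflectionPerm_self, isPos_reflectionPerm_self_iff, isPos_reflectionPerm_self_iff]
        refine ⟨fun h5 ↦ ?_, hj.2⟩
        have := mem_posRoots.2 h5
        rw [← inversions_longest hw₀, mem_inversions, h3] at this
        exact this.2 hj.1
      · rw [h4]
        apply P.root.injective
        rw [root_reflectionPerm_self, root_reflectionPerm_self, neg_neg]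
  rw [length_eq_card, length_eq_card w, h1, h2, length_longest hw₀, add_comm]
  exact Finset.card_filter_add_card_filter_not _

lemma eq_longest_of_length_eq {w : P.weylGroup} (h : length b w = length b w₀) : w = w₀ := by
  have := length_mul_longest hw₀ (w * w₀⁻¹)
  rw [inv_mul_cancel_right, h] at this
  exact mul_inv_eq_one.1 ((length_eq_zero (b := b)).1 (by omega))

end Longest

end Length

/-! ### Divided differences -/

section DividedDifferences

variable {P : RootPairing ι ℚ M N}

/-- Evaluation at points of `N` separates elements of `M`, because the pairing is perfect. -/
lemma ι_injective (P : RootPairing ι ℚ M N) :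
    Function.Injective (SymmetricAlgebra.ι ℚ M) := by
  rw [← LinearMap.ker_eq_bot, LinearMap.ker_eq_bot']
  intro x hx
  have h (y : N) : P.toLinearMap x y = 0 := by
    have := congrArg (SymmetricAlgebra.lift (P.toLinearMap.flip y)) hx
    simpa using this
  apply P.toPerfPair.injective
  ext y
  simpa using h y

lemma rootElt_ne_zero (i : ι) : rootElt P i ≠ 0 := by
  rw [rootElt, Ne, map_eq_zero_iff _ (ι_injective P)]
  exact P.ne_zero i

lemma act_ι (w : P.weylGroup) (x : M) :
    act P w (SymmetricAlgebra.ι ℚ M x) = SymmetricAlgebra.ι ℚ M (P.weylGroupRootRep w x) := by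
  simp [act]

lemma act_rootElt (w : P.weylGroup) (i : ι) :
    act P w (rootElt P i) = rootElt P (perm P w i) := by
  rw [rootElt, act_ι, rootElt, root_perm]

lemma act_mul (u v : P.weylGroup) (f : SymmetricAlgebra ℚ M) :
    act P (u * v) f = act P u (act P v f) := by
  have h : act P (u * v) = (act P u).comp (act P v) := by
    apply SymmetricAlgebra.algHom_ext
    ext x
    simp [act_ι]
  rw [h]; rfl

lemma act_one (f : SymmetricAlgebra ℚ M) : act P 1 f = f := by
  have h : act P 1 = AlgHom.id ℚ _ := by
    apply SymmetricAlgebra.algHom_ext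
    ext x
    simp [act_ι]
  rw [h]; rfl

lemma act_ofIdx_act_ofIdx (i : ι) (f : SymmetricAlgebra ℚ M) :
    act P (weylGroup.ofIdx P i) (act P (weylGroup.ofIdx P i) f) = f := by
  rw [← act_mul, ofIdx_mul_self, act_one]

lemma rootElt_reflectionPerm_self (i : ι) : rootElt P (P.reflectionPerm i i) = -rootElt P i := by
  rw [rootElt, root_reflectionPerm_self, map_neg, rootElt]

lemma act_injective : Function.Injective (act P) := by
  intro u v h
  apply rootRep_injective
  ext x
  apply ι_injective P
  rw [← act_ι, ← act_ι, h]

lemma divDiff_eq_iff {i : ι} {f g : SymmetricAlgebra ℚ M} :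
    divDiff P i f = g ↔ rootElt P i * g = f - act P (weylGroup.ofIdx P i) f := by
  rw [← rootElt_mul_divDiff, mul_right_inj' (rootElt_ne_zero i), eq_comm]

variable (P) in
/-- The divided difference as a linear map. -/
def divDiffLin (i : ι) : SymmetricAlgebra ℚ M →ₗ[ℚ] SymmetricAlgebra ℚ M where
  toFun := divDiff P i
  map_add' f g := by
    rw [divDiff_eq_iff, mul_add, rootElt_mul_divDiff, rootElt_mul_divDiff, map_add]; ring
  map_smul' c f := by
    rw [divDiff_eq_iff, mul_smul_comm, RingHom.id_apply, rootElt_mul_divDiff, map_smul, smul_sub]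

lemma divDiff_add (i : ι) (f g : SymmetricAlgebra ℚ M) :
    divDiff P i (f + g) = divDiff P i f + divDiff P i g := map_add (divDiffLin P i) f g

lemma divDiff_sum {κ : Type*} (i : ι) (s : Finset κ) (f : κ → SymmetricAlgebra ℚ M) :
    divDiff P i (∑ k ∈ s, f k) = ∑ k ∈ s, divDiff P i (f k) := map_sum (divDiffLin P i) f s

lemma divDiff_smul (i : ι) (c : ℚ) (f : SymmetricAlgebra ℚ M) :
    divDiff P i (c • f) = c • divDiff P i f := map_smul (divDiffLin P i) c f

lemma divDiff_zero (i : ι) : divDiff P i 0 = 0 := map_zero (divDiffLin P i)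

/-- The twisted Leibniz rule. -/
lemma divDiff_mul (i : ι) (f g : SymmetricAlgebra ℚ M) :
    divDiff P i (f * g) =
      divDiff P i f * g + act P (weylGroup.ofIdx P i) f * divDiff P i g := by
  rw [divDiff_eq_iff, mul_add, ← mul_assoc, rootElt_mul_divDiff, mul_left_comm,
    rootElt_mul_divDiff, map_mul]
  ring

lemma divDiff_eq_zero_iff {i : ι} {f : SymmetricAlgebra ℚ M} :
    divDiff P i f = 0 ↔ act P (weylGroup.ofIdx P i) f = f := by
  rw [divDiff_eq_iff, mul_zero, eq_comm, sub_eq_zero, eq_comm]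

lemma act_divDiff (i : ι) (f : SymmetricAlgebra ℚ M) :
    act P (weylGroup.ofIdx P i) (divDiff P i f) = divDiff P i f := by
  have h := congrArg (act P (weylGroup.ofIdx P i)) (rootElt_mul_divDiff P i f)
  rw [map_mul, act_rootElt, perm_ofIdx, rootElt_reflectionPerm_self, map_sub,
    act_ofIdx_act_ofIdx] at h
  symm
  rw [divDiff_eq_iff]
  linear_combination -h

lemma divDiff_divDiff (i : ι) (f : SymmetricAlgebra ℚ M) : divDiff P i (divDiff P i f) = 0 :=
  divDiff_eq_zero_iff.2 (act_divDiff i f)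

lemma divDiff_act (i : ι) (f : SymmetricAlgebra ℚ M) :
    divDiff P i (act P (weylGroup.ofIdx P i) f) = -divDiff P i f := by
  rw [divDiff_eq_iff, mul_neg, rootElt_mul_divDiff, act_ofIdx_act_ofIdx]; ring

lemma divDiff_ι (i : ι) (x : M) :
    divDiff P i (SymmetricAlgebra.ι ℚ M x) =
      algebraMap ℚ _ (P.toLinearMap x (P.coroot i)) := by
  rw [divDiff_eq_iff, act_ι, rootRep_ofIdx, reflection_apply, map_sub, map_smul, rootElt,
    Algebra.smul_def, mul_comm]
  simp

lemma divDiff_algebraMap (i : ι) (c : ℚ) :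
    divDiff P i (algebraMap ℚ (SymmetricAlgebra ℚ M) c) = 0 := by
  rw [divDiff_eq_zero_iff, AlgHom.commutes]

lemma divDiff_mul_of_invariant (i : ι) {f : SymmetricAlgebra ℚ M}
    (hf : ∀ w : P.weylGroup, act P w f = f) (g : SymmetricAlgebra ℚ M) :
    divDiff P i (f * g) = f * divDiff P i g := by
  rw [divDiff_mul, hf, divDiff_eq_zero_iff.2 (hf _), zero_mul, zero_add]

end DividedDifferences

/-! ### Operators of words: independence of the reduced word -/

section Words

variable {P : RootPairing ι ℚ M N} (b : P.Base)

lemma divDiffWord_cons (i : b.support) (l : List b.support) (f : SymmetricAlgebra ℚ M) :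
    divDiffWord b (i :: l) f = divDiff P i (divDiffWord b l f) := rfl

lemma divDiffWord_append (l l' : List b.support) (f : SymmetricAlgebra ℚ M) :
    divDiffWord b (l ++ l') f = divDiffWord b l (divDiffWord b l' f) := by
  simp [divDiffWord]

/-- The operator of a word as a linear map. -/
def divDiffWordLin (l : List b.support) : SymmetricAlgebra ℚ M →ₗ[ℚ] SymmetricAlgebra ℚ M where
  toFun := divDiffWord b l
  map_add' f g := by
    induction l with
    | nil => rfl
    | cons i l ih => simp only [divDiffWord_cons, ih, divDiff_add]
  map_smul' c f := by
    induction l with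
    | nil => rfl
    | cons i l ih => simp only [divDiffWord_cons, ih, divDiff_smul, RingHom.id_apply]

lemma divDiffWord_smul (l : List b.support) (c : ℚ) (f : SymmetricAlgebra ℚ M) :
    divDiffWord b l (c • f) = c • divDiffWord b l f := map_smul (divDiffWordLin b l) c f

lemma divDiffWord_mul_of_invariant (l : List b.support) {f : SymmetricAlgebra ℚ M}
    (hf : ∀ w : P.weylGroup, act P w f = f) (g : SymmetricAlgebra ℚ M) :
    divDiffWord b l (f * g) = f * divDiffWord b l g := by
  induction l with
  | nil => rfl
  | cons i l ih => rw [divDiffWord_cons, ih, divDiff_mul_of_invariant _ hf, divDiffWord_cons]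

lemma divDiffWord_algebraMap {l : List b.support} (hl : l ≠ []) (c : ℚ) :
    divDiffWord b l (algebraMap ℚ (SymmetricAlgebra ℚ M) c) = 0 := by
  induction l with
  | nil => exact absurd rfl hl
  | cons i l ih =>
    rw [divDiffWord_cons]
    rcases eq_or_ne l [] with rfl | h
    · exact divDiff_algebraMap _ _
    · rw [ih h, divDiff_zero]

variable [Fintype ι] [P.IsCrystallographic] [P.IsReduced] [P.IsRootSystem]

open scoped Classical in
/-- The operator `A_w` (for a chosen reduced word) if `w` has length `n`, and zero otherwise. -/
def divDiffOfLength (n : ℕ) (w : P.weylGroup) (f : SymmetricAlgebra ℚ M) : SymmetricAlgebra ℚ M :=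
  if length b w = n then divDiffWord b (exists_isReducedWord b w).choose f else 0

variable {b}

/-- The hypothesis `hn` is the independence theorem in length `n + 1`, supplied by the induction in
which this lemma is used. If `w` is shorter than `n`, both sides are zero. -/
lemma divDiff_divDiffOfLength {n : ℕ}
    (hn : ∀ (l : List b.support) (f : SymmetricAlgebra ℚ M), l.length = n + 1 →
      divDiffWord b l f = divDiffOfLength b (n + 1) (wordProd b l) f)
    (i : b.support) {w : P.weylGroup} (hw : length b w ≤ n) (f : SymmetricAlgebra ℚ M) :
    divDiff P i (divDiffOfLength b n w f) =
      divDiffOfLength b (n + 1) (weylGroup.ofIdx P i * w) f := by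
  by_cases h : length b w = n
  · have hr := (exists_isReducedWord b w).choose_spec
    rw [divDiffOfLength, if_pos h, ← divDiffWord_cons, hn, wordProd_cons, hr.1]
    rw [List.length_cons, hr.2, h]
  · rw [divDiffOfLength, if_neg h, divDiff_zero, divDiffOfLength, if_neg]
    have := length_ofIdx_mul_le i w
    omega

/-- Iterated Leibniz rule: each new letter differentiates the linear form once, and this term
belongs to the one inversion that the letter adds. A product `w σ_γ` has length at most `l.length -
1`, and only those attaining it contribute. For the empty word the sum is empty, so truncated
subtraction is harmless. -/
lemma divDiffWord_ι_mul {n : ℕ}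
    (hn : ∀ m ≤ n, ∀ (l : List b.support) (f : SymmetricAlgebra ℚ M), l.length = m →
      divDiffWord b l f = divDiffOfLength b m (wordProd b l) f)
    {l : List b.support} (hl : IsReducedWord b (wordProd b l) l) (hln : l.length ≤ n + 1)
    (x : M) (f : SymmetricAlgebra ℚ M) :
    divDiffWord b l (SymmetricAlgebra.ι ℚ M x * f) =
      SymmetricAlgebra.ι ℚ M (P.weylGroupRootRep (wordProd b l) x) * divDiffWord b l f +
        ∑ γ ∈ inversions b (wordProd b l), P.toLinearMap x (P.coroot γ) •
          divDiffOfLength b (l.length - 1) (wordProd b l * weylGroup.ofIdx P γ) f := by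
  classical
  induction l with
  | nil => simp [wordProd, divDiffWord, inversions]
  | cons i l ih =>
    rw [List.length_cons] at hln
    have hpos := hl.isPos
    have hcoef : P.toLinearMap (P.weylGroupRootRep (wordProd b l) x) (P.coroot i) =
        P.toLinearMap x (P.coroot (perm P (wordProd b l)⁻¹ i)) := by
      rw [← pairing_rootRep (wordProd b l)⁻¹, ← Module.End.mul_apply, ← map_mul]
      simp
    rw [divDiffWord_cons, ih hl.tail (by omega), divDiff_add, divDiff_mul, divDiff_ι, act_ι,
      divDiff_sum, wordProd_cons, inversions_ofIdx_mul hpos,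
      Finset.sum_insert perm_inv_notMem_inversions, hcoef, map_mul, Module.End.mul_apply,
      List.length_cons, Nat.add_sub_cancel, divDiffWord_cons, ofIdx_perm]
    have h1 : weylGroup.ofIdx P i * wordProd b l * ((wordProd b l)⁻¹ * weylGroup.ofIdx P i *
        (wordProd b l)⁻¹⁻¹) = wordProd b l := by
      simp [mul_assoc, ofIdx_mul_cancel_left]
    rw [h1, ← hn l.length (by omega) l f rfl, ← Algebra.smul_def]
    have h2 : ∀ γ ∈ inversions b (wordProd b l), divDiff P i (P.toLinearMap x (P.coroot γ) •
        divDiffOfLength b (l.length - 1) (wordProd b l * weylGroup.ofIdx P γ) f) =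
        P.toLinearMap x (P.coroot γ) • divDiffOfLength b l.length
          (weylGroup.ofIdx P i * wordProd b l * weylGroup.ofIdx P γ) f := by
      intro γ hγ
      have h3 := length_mul_ofIdx_lt hγ
      rw [← hl.tail.2] at h3
      obtain ⟨k, hk⟩ : ∃ k, l.length = k + 1 := ⟨l.length - 1, by omega⟩
      rw [divDiff_smul, hk, Nat.add_sub_cancel, divDiff_divDiffOfLength _ _ (by omega), mul_assoc]
      intro l' f hl'
      exact hn _ (by omega) l' f hl'
    rw [Finset.sum_congr rfl h2]
    ring

/-- Linear forms generate the algebra, so an operator that is linear up to the twist by `w` is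
determined by its value at `1`. -/
lemma eq_zero_of_semilinear {w : P.weylGroup}
    (X : SymmetricAlgebra ℚ M →ₗ[ℚ] SymmetricAlgebra ℚ M)
    (h1 : X 1 = 0) (hX : ∀ (x : M) (f : SymmetricAlgebra ℚ M), X (SymmetricAlgebra.ι ℚ M x * f) =
      SymmetricAlgebra.ι ℚ M (P.weylGroupRootRep w x) * X f) : X = 0 := by
  have key (f : SymmetricAlgebra ℚ M) : ∀ g, X (f * g) = act P w f * X g := by
    induction f using SymmetricAlgebra.induction with
    | algebraMap r => intro g; simp [← Algebra.smul_def]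
    | ι x => intro g; rw [hX, act_ι]
    | mul f f' hf hf' => intro g; rw [mul_assoc, hf, hf', map_mul, mul_assoc]
    | add f f' hf hf' => intro g; rw [add_mul, map_add, hf, hf', map_add, add_mul]
  ext f
  rw [← mul_one f, key, h1, mul_zero, LinearMap.zero_apply]

/-- The operator of a word vanishes unless the word is reduced, and depends only on its product. -/
theorem divDiffWord_eq_divDiffOfLength (n : ℕ) (l : List b.support) (f : SymmetricAlgebra ℚ M)
    (hl : l.length = n) : divDiffWord b l f = divDiffOfLength b n (wordProd b l) f := by
  induction n using Nat.strong_induction_on generalizing l f with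
  | _ n ih =>
    have ih' {l : List b.support} (f : SymmetricAlgebra ℚ M) (h : l.length < n) :=
      ih _ h l f rfl
    by_cases hred : length b (wordProd b l) = n
    · have hr := (exists_isReducedWord b (wordProd b l)).choose_spec
      rw [divDiffOfLength, if_pos hred]
      set l' := (exists_isReducedWord b (wordProd b l)).choose
      rcases n with - | n
      · rw [List.length_eq_zero_iff] at hl
        have : l' = [] := by rw [← List.length_eq_zero_iff, hr.2, hred]
        rw [this, hl]
      have hl' : l'.length = n + 1 := hr.2.trans hred
      suffices divDiffWordLin b l - divDiffWordLin b l' = 0 from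
        LinearMap.congr_fun (sub_eq_zero.1 this) f
      have hne {l : List b.support} (h : l.length = n + 1) : l ≠ [] := by
        rintro rfl; simp at h
      have hone {l : List b.support} (h : l ≠ []) :
          divDiffWord b l (1 : SymmetricAlgebra ℚ M) = 0 := by
        rw [← map_one (algebraMap ℚ (SymmetricAlgebra ℚ M))]
        exact divDiffWord_algebraMap b h 1
      have hn : ∀ m ≤ n, ∀ (l : List b.support) (f : SymmetricAlgebra ℚ M), l.length = m →
          divDiffWord b l f = divDiffOfLength b m (wordProd b l) f :=
        fun m hm l f hlm ↦ ih m (by omega) l f hlm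
      -- The inversion sums of the two words involve only shorter operators and the common product,
      -- so they cancel in the difference. Both words are nonempty, hence kill `1`.
      refine eq_zero_of_semilinear (w := wordProd b l) _ ?_ fun x f ↦ ?_
      · change divDiffWord b l 1 - divDiffWord b l' 1 = 0
        rw [hone (hne hl), hone (hne hl'), sub_zero]
      · change divDiffWord b l _ - divDiffWord b l' _ =
          _ * (divDiffWord b l f - divDiffWord b l' f)
        rw [divDiffWord_ι_mul hn ⟨rfl, by omega⟩ (by omega),
          divDiffWord_ι_mul hn ⟨rfl, by rw [hr.1]; omega⟩ (by omega), hr.1, hl, hl']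
        ring
    · rw [divDiffOfLength, if_neg hred]
      match l, hl with
      | [], hl =>
        have := length_wordProd_le b []
        simp only [List.length_nil] at hl this
        omega
      | i :: l, hl =>
        rw [List.length_cons] at hl
        rw [divDiffWord_cons, ih' f (by omega), divDiffOfLength]
        split_ifs with h
        · have h1 : ¬ b.IsPos (perm P (wordProd b l)⁻¹ i) := fun hpos ↦ by
            have := length_ofIdx_mul_of_isPos hpos
            rw [← wordProd_cons] at this
            omega
          have h2 := length_ofIdx_mul_of_not_isPos h1
          -- The tail is reduced but `i` shortens its product, which therefore also has a reduced
          -- word `i :: m`. By induction the operator of the tail starts with `A_i`, and `A_i ∘ A_i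
          -- = 0`.
          obtain ⟨m, hm1, hm2⟩ := exists_isReducedWord b (weylGroup.ofIdx P i * wordProd b l)
          have h3 : wordProd b (i :: m) = wordProd b l := by
            rw [wordProd_cons, hm1, ofIdx_mul_cancel_left]
          have h4 := ih' (l := i :: m) f (by rw [List.length_cons]; omega)
          rw [h3, List.length_cons, hm2, h2, divDiffOfLength, if_pos rfl] at h4
          rw [← h4, divDiffWord_cons, divDiff_divDiff]
        · exact divDiff_zero _

lemma divDiffWord_eq_zero {l : List b.support} (hl : length b (wordProd b l) < l.length)
    (f : SymmetricAlgebra ℚ M) : divDiffWord b l f = 0 := by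
  rw [divDiffWord_eq_divDiffOfLength _ l f rfl, divDiffOfLength, if_neg hl.ne]

lemma divDiffWord_congr {w : P.weylGroup} {l l' : List b.support} (hl : IsReducedWord b w l)
    (hl' : IsReducedWord b w l') (f : SymmetricAlgebra ℚ M) :
    divDiffWord b l f = divDiffWord b l' f := by
  rw [divDiffWord_eq_divDiffOfLength _ l f rfl, divDiffWord_eq_divDiffOfLength _ l' f rfl,
    hl.1, hl'.1, hl.2, hl'.2]

end Words

/-! ### Nonvanishing of the operators of reduced words -/

section Nonvanishing

variable {P : RootPairing ι ℚ M N} (b : P.Base)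
variable [Fintype ι] [P.IsCrystallographic] [P.IsReduced] [P.IsRootSystem]

local notation "R" => SymmetricAlgebra ℚ M

/-- Use `σ_i = 1 - α_i A_i`; by the Leibniz rule the `R`-span of the operators is stable under
composition with `A_i` on the left. -/
lemma act_mem_span_divDiffWord (w : P.weylGroup) :
    (fun f ↦ act P w f) ∈ Submodule.span R (Set.range (divDiffWord b)) := by
  have step (i : b.support) (X : R → R) (hX : X ∈ Submodule.span R (Set.range (divDiffWord b))) :
      (fun f ↦ divDiff P i (X f)) ∈ Submodule.span R (Set.range (divDiffWord b)) := by
    induction hX using Submodule.span_induction with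
    | mem X hX =>
      obtain ⟨l, rfl⟩ := hX
      exact Submodule.subset_span ⟨i :: l, rfl⟩
    | zero => simp only [Pi.zero_apply, divDiff_zero]; exact Submodule.zero_mem _
    | add X Y _ _ hX hY =>
      simp only [Pi.add_apply, divDiff_add]
      exact Submodule.add_mem _ hX hY
    | smul p X h hX =>
      simp only [Pi.smul_apply, smul_eq_mul, divDiff_mul]
      exact Submodule.add_mem _ (Submodule.smul_mem _ (divDiff P i p) h)
        (Submodule.smul_mem _ (act P (weylGroup.ofIdx P i) p) hX)
  obtain ⟨l, rfl⟩ := exists_word b w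
  induction l with
  | nil =>
    refine Submodule.subset_span ⟨[], ?_⟩
    funext f
    simp [wordProd, act_one, divDiffWord]
  | cons i l ih =>
    have h : (fun f ↦ act P (wordProd b (i :: l)) f) =
        (fun f ↦ act P (wordProd b l) f) -
          rootElt P i • fun f ↦ divDiff P i (act P (wordProd b l) f) := by
      funext f
      simp only [Pi.sub_apply, Pi.smul_apply, smul_eq_mul, rootElt_mul_divDiff, wordProd_cons,
        act_mul]
      ring
    rw [h]
    exact Submodule.sub_mem _ ih (Submodule.smul_mem _ _ (step i _ ih))

lemma linearIndependent_act :
    LinearIndependent R (fun (w : P.weylGroup) (f : R) ↦ act P w f) := by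
  have h := (linearIndependent_monoidHom R R).comp
    (fun w : P.weylGroup ↦ ((act P w : R →ₐ[ℚ] R) : R →* R)) (fun u v huv ↦ ?_)
  · exact h
  · apply act_injective
    ext1
    ext x
    exact DFunLike.congr_fun huv (SymmetricAlgebra.ι ℚ M x)

variable {b}

/-- If one operator vanished, the `|W|` automorphisms, independent over `R` by Dedekind, would lie
in the span of at most `|W| - 1` operators. -/
lemma exists_divDiffWord_ne_zero {w : P.weylGroup} {l : List b.support}
    (hl : IsReducedWord b w l) : ∃ f : R, divDiffWord b l f ≠ 0 := by
  classical
  by_contra! h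
  let A (v : P.weylGroup) : R → R := divDiffWord b (exists_isReducedWord b v).choose
  let s : Finset (R → R) := (Finset.univ.erase w).image A
  have hs : Submodule.span R (Set.range (divDiffWord b)) ≤
      Submodule.span R (s : Set (R → R)) := by
    rw [Submodule.span_le]
    rintro _ ⟨m, rfl⟩
    by_cases hm : length b (wordProd b m) = m.length
    · have hm' : divDiffWord b m = A (wordProd b m) := by
        funext f
        exact divDiffWord_congr ⟨rfl, hm.symm⟩ (exists_isReducedWord b _).choose_spec f
      rcases eq_or_ne (wordProd b m) w with hw | hw
      · have : divDiffWord b m = (0 : R → R) := by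
          funext f
          rw [divDiffWord_congr ⟨hw, by rw [← hw, hm]⟩ hl f, h]; rfl
        rw [this]
        exact Submodule.zero_mem _
      · rw [hm']
        exact Submodule.subset_span (Finset.mem_coe.2 (Finset.mem_image_of_mem _ (by simpa)))
    · have : divDiffWord b m = (0 : R → R) := by
        funext f
        exact divDiffWord_eq_zero (lt_of_le_of_ne (length_wordProd_le b m) hm) f
      rw [this]
      exact Submodule.zero_mem _
  have h1 := linearIndependent_le_span' _ (linearIndependent_act (P := P)) (s : Set (R → R)) (by
    rintro _ ⟨v, rfl⟩
    exact hs (act_mem_span_divDiffWord b v))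
  rw [Cardinal.mk_fintype, Nat.cast_le] at h1
  simp only [Finset.coe_sort_coe, Fintype.card_coe] at h1
  have h2 : s.card ≤ _ := Finset.card_image_le
  rw [Finset.card_erase_of_mem (Finset.mem_univ _), Finset.card_univ] at h2
  have : 0 < Fintype.card P.weylGroup := Fintype.card_pos
  omega

end Nonvanishing

/-! ### The degree filtration -/

section Degree

variable {P : RootPairing ι ℚ M N}

lemma evalAt_algebraMap (h : N) (c : ℚ) :
    evalAt P h (algebraMap ℚ (SymmetricAlgebra ℚ M) c) = c := by
  rw [AlgHom.commutes]; rfl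

lemma evalAt_zero_act (w : P.weylGroup) (f : SymmetricAlgebra ℚ M) :
    evalAt P 0 (act P w f) = evalAt P 0 f := by
  have h : (evalAt P 0).comp (act P w) = evalAt P 0 := by
    apply SymmetricAlgebra.algHom_ext
    ext x
    simp [evalAt, act_ι]
  exact DFunLike.congr_fun h f

lemma mem_degreeLE_zero {f : SymmetricAlgebra ℚ M} :
    f ∈ degreeLE M 0 ↔ ∃ c : ℚ, algebraMap ℚ _ c = f := by
  rw [degreeLE, pow_zero, Submodule.mem_one]

lemma degreeLE_mono : Monotone (degreeLE M) :=
  monotone_nat_of_le_succ fun n ↦ by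
    rw [degreeLE, degreeLE, pow_succ]
    exact (mul_one _).symm.le.trans (mul_le_mul' le_rfl le_sup_left)

lemma mul_mem_degreeLE {m n : ℕ} {f g : SymmetricAlgebra ℚ M} (hf : f ∈ degreeLE M m)
    (hg : g ∈ degreeLE M n) : f * g ∈ degreeLE M (m + n) := by
  rw [degreeLE, pow_add]
  exact Submodule.mul_mem_mul hf hg

lemma ι_mem_degreeLE (x : M) : SymmetricAlgebra.ι ℚ M x ∈ degreeLE M 1 := by
  rw [degreeLE, pow_one]
  exact Submodule.mem_sup_right ⟨x, rfl⟩

lemma algebraMap_mem_degreeLE (c : ℚ) : algebraMap ℚ (SymmetricAlgebra ℚ M) c ∈ degreeLE M 0 :=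
  mem_degreeLE_zero.2 ⟨c, rfl⟩

lemma exists_mem_degreeLE (f : SymmetricAlgebra ℚ M) : ∃ n, f ∈ degreeLE M n := by
  induction f using SymmetricAlgebra.induction with
  | algebraMap r => exact ⟨0, algebraMap_mem_degreeLE r⟩
  | ι x => exact ⟨1, ι_mem_degreeLE x⟩
  | mul f g hf hg =>
    obtain ⟨m, hm⟩ := hf
    obtain ⟨n, hn⟩ := hg
    exact ⟨m + n, mul_mem_degreeLE hm hn⟩
  | add f g hf hg =>
    obtain ⟨m, hm⟩ := hf
    obtain ⟨n, hn⟩ := hg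
    exact ⟨max m n, Submodule.add_mem _ (degreeLE_mono (le_max_left m n) hm)
      (degreeLE_mono (le_max_right m n) hn)⟩

lemma act_mem_degreeLE (w : P.weylGroup) {n : ℕ} {f : SymmetricAlgebra ℚ M}
    (hf : f ∈ degreeLE M n) : act P w f ∈ degreeLE M n := by
  have h : (1 ⊔ LinearMap.range (SymmetricAlgebra.ι ℚ M)).map (act P w).toLinearMap ≤
      1 ⊔ LinearMap.range (SymmetricAlgebra.ι ℚ M) := by
    rw [Submodule.map_sup, Submodule.map_one]
    refine sup_le_sup_left ?_ _
    rintro _ ⟨_, ⟨x, rfl⟩, rfl⟩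
    exact ⟨_, (act_ι w x).symm⟩
  have h' : (degreeLE M n).map (act P w).toLinearMap ≤ degreeLE M n := by
    rw [degreeLE, Submodule.map_pow]
    exact pow_le_pow_left' h n
  exact h' ⟨f, hf, rfl⟩

lemma divDiff_mem_degreeLE (i : ι) {n : ℕ} {f : SymmetricAlgebra ℚ M}
    (hf : f ∈ degreeLE M (n + 1)) : divDiff P i f ∈ degreeLE M n := by
  induction n generalizing f with
  | zero =>
    rw [zero_add, degreeLE, pow_one] at hf
    obtain ⟨g, hg, _, ⟨x, rfl⟩, rfl⟩ := Submodule.mem_sup.1 hf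
    obtain ⟨c, rfl⟩ := Submodule.mem_one.1 hg
    rw [divDiff_add, divDiff_algebraMap, zero_add, divDiff_ι]
    exact algebraMap_mem_degreeLE _
  | succ n ih =>
    rw [degreeLE, pow_succ] at hf
    refine Submodule.mul_induction_on hf (fun f hf g hg ↦ ?_) (fun f g hf hg ↦ ?_)
    · rw [divDiff_mul, mul_comm]
      obtain ⟨g', hg', _, ⟨x, rfl⟩, rfl⟩ := Submodule.mem_sup.1 hg
      obtain ⟨c, rfl⟩ := Submodule.mem_one.1 hg'
      rw [mul_comm (algebraMap ℚ _ c + _)]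
      refine Submodule.add_mem _ ?_ ?_
      · refine mul_mem_degreeLE (ih hf) ?_
        rwa [degreeLE, pow_one]
      · rw [divDiff_add, divDiff_algebraMap, zero_add, divDiff_ι, mul_comm, ← Algebra.smul_def]
        refine Submodule.smul_mem _ _ ?_
        exact act_mem_degreeLE _ hf
    · rw [divDiff_add]
      exact Submodule.add_mem _ hf hg

lemma divDiffWord_mem_degreeLE (b : P.Base) (l : List b.support) {n : ℕ} {f : SymmetricAlgebra ℚ M}
    (hf : f ∈ degreeLE M (l.length + n)) : divDiffWord b l f ∈ degreeLE M n := by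
  induction l generalizing n with
  | nil => simpa [divDiffWord] using hf
  | cons i l ih =>
    rw [divDiffWord_cons]
    refine divDiff_mem_degreeLE _ (ih ?_)
    rw [List.length_cons] at hf
    rwa [← add_assoc, add_right_comm]

end Degree

/-! ### The coinvariant ideal -/

section Coinvariant

variable {P : RootPairing ι ℚ M N}

lemma act_mem_coinvariantIdeal (w : P.weylGroup) {f : SymmetricAlgebra ℚ M}
    (hf : f ∈ coinvariantIdeal P) : act P w f ∈ coinvariantIdeal P := by
  have h : coinvariantIdeal P ≤ (coinvariantIdeal P).comap (act P w) := by
    conv_lhs => rw [coinvariantIdeal]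
    rw [Ideal.span_le]
    intro g hg
    rw [SetLike.mem_coe, Ideal.mem_comap, hg.1]
    exact Ideal.subset_span hg
  exact h hf

lemma evalAt_zero_of_mem_coinvariantIdeal {f : SymmetricAlgebra ℚ M}
    (hf : f ∈ coinvariantIdeal P) : evalAt P 0 f = 0 := by
  have h : coinvariantIdeal P ≤ RingHom.ker (evalAt P 0) :=
    Ideal.span_le.2 fun g hg ↦ (RingHom.mem_ker).2 hg.2
  exact (RingHom.mem_ker).1 (h hf)

/-- A linear operator commuting with multiplication by invariants preserves the coinvariant
ideal. -/
lemma map_mem_coinvariantIdeal (T : SymmetricAlgebra ℚ M →ₗ[ℚ] SymmetricAlgebra ℚ M)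
    (hT : ∀ f : SymmetricAlgebra ℚ M, (∀ w : P.weylGroup, act P w f = f) →
      ∀ g, T (f * g) = f * T g)
    {f : SymmetricAlgebra ℚ M} (hf : f ∈ coinvariantIdeal P) : T f ∈ coinvariantIdeal P := by
  rw [coinvariantIdeal, Ideal.span, ← Set.image_id {f | _}] at hf
  -- `T` is not `R`-linear, so the induction has to carry all multiples `g * f` at once.
  refine Submodule.span_induction (p := fun f _ ↦ ∀ g, T (g * f) ∈ coinvariantIdeal P)
    ?_ ?_ ?_ ?_ hf 1 |> fun h ↦ by simpa using h
  · rintro _ ⟨x, hx, rfl⟩ g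
    rw [id, mul_comm, hT _ hx.1]
    exact Ideal.mul_mem_right _ _ (Ideal.subset_span hx)
  · intro g; simp
  · intro x y _ _ hx hy g
    rw [mul_add, map_add]
    exact Ideal.add_mem _ (hx g) (hy g)
  · intro a x _ hx g
    rw [smul_eq_mul, ← mul_assoc]
    exact hx _

lemma divDiffWord_mem_coinvariantIdeal (b : P.Base) (l : List b.support)
    {f : SymmetricAlgebra ℚ M} (hf : f ∈ coinvariantIdeal P) :
    divDiffWord b l f ∈ coinvariantIdeal P :=
  map_mem_coinvariantIdeal (divDiffWordLin b l)
    (fun _ hf g ↦ divDiffWord_mul_of_invariant b l hf g) hf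

variable [Fintype ι] [P.IsCrystallographic] [P.IsReduced] [P.IsRootSystem] (b : P.Base)

lemma act_sum_act (w : P.weylGroup) (f : SymmetricAlgebra ℚ M) :
    act P w (∑ v : P.weylGroup, act P v f) = ∑ v : P.weylGroup, act P v f := by
  rw [map_sum]
  simp_rw [← act_mul]
  exact Fintype.sum_equiv (Equiv.mulLeft w) _ _ fun _ ↦ rfl

/-- Each `A_i f` inherits the hypothesis in lower degree, so it lies in `J`, and so does `f - σ_i f
= α_i A_i f`. As `J` is stable under `W`, `f` is congruent to all its translates and so to their
average, an invariant without constant term. -/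
lemma mem_coinvariantIdeal_of_forall_evalAt {f : SymmetricAlgebra ℚ M}
    (hf : ∀ l : List b.support, evalAt P 0 (divDiffWord b l f) = 0) :
    f ∈ coinvariantIdeal P := by
  obtain ⟨n, hn⟩ := exists_mem_degreeLE f
  induction n generalizing f with
  | zero =>
    obtain ⟨c, rfl⟩ := mem_degreeLE_zero.1 hn
    have h0 : evalAt P 0 (algebraMap ℚ (SymmetricAlgebra ℚ M) c) = 0 := hf []
    rw [evalAt_algebraMap] at h0
    rw [h0, map_zero]
    exact Ideal.zero_mem _
  | succ n ih =>
    have hA (i : b.support) : divDiff P i f ∈ coinvariantIdeal P := by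
      refine ih (fun l ↦ ?_) (divDiff_mem_degreeLE _ hn)
      have := hf (l ++ [i])
      rwa [divDiffWord_append] at this
    have hact (w : P.weylGroup) : f - act P w f ∈ coinvariantIdeal P := by
      obtain ⟨l, rfl⟩ := exists_word b w
      induction l with
      | nil => simp [wordProd, act_one]
      | cons i l ihl =>
        have h1 := Ideal.mul_mem_left _ (rootElt P i) (hA i)
        rw [rootElt_mul_divDiff] at h1
        have h2 := Ideal.add_mem _ h1 (act_mem_coinvariantIdeal (weylGroup.ofIdx P i) ihl)
        rwa [map_sub, ← act_mul, ← wordProd_cons, sub_add_sub_cancel] at h2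
    have hcard : (Fintype.card P.weylGroup : ℚ) ≠ 0 := by simp
    have h1 : ∑ w : P.weylGroup, act P w f ∈ coinvariantIdeal P := by
      refine Ideal.subset_span ⟨fun w ↦ act_sum_act w f, ?_⟩
      have h0 : evalAt P 0 f = 0 := hf []
      rw [map_sum]
      simp [evalAt_zero_act, h0]
    have h2 : f = algebraMap ℚ _ (Fintype.card P.weylGroup : ℚ)⁻¹ *
        (∑ w : P.weylGroup, (f - act P w f) + ∑ w : P.weylGroup, act P w f) := by
      rw [← Finset.sum_add_distrib]
      simp only [sub_add_cancel, Finset.sum_const, Finset.card_univ]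
      rw [← Algebra.smul_def, ← Nat.cast_smul_eq_nsmul ℚ, smul_smul, inv_mul_cancel₀ hcard, one_smul]
    rw [h2]
    exact Ideal.mul_mem_left _ _ (Ideal.add_mem _ (Ideal.sum_mem _ fun w _ ↦ hact w) h1)

end Coinvariant

/-! ### Divisibility by roots -/

section Divisibility

variable (P : RootPairing ι ℚ M N)

/-- The projection of `𝔥^*` with kernel spanned by a root. -/
def rootProj (i : ι) : M →ₗ[ℚ] M :=
  LinearMap.id - (1 / 2 : ℚ) • (P.toLinearMap.flip (P.coroot i)).smulRight (P.root i)

/-- Restriction of a polynomial to the hyperplane of a root, extended back to `𝔥` along the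
coroot. -/
def restrict (i : ι) : SymmetricAlgebra ℚ M →ₐ[ℚ] SymmetricAlgebra ℚ M :=
  SymmetricAlgebra.lift (SymmetricAlgebra.ι ℚ M ∘ₗ rootProj P i)

variable {P}

lemma rootProj_apply (i : ι) (x : M) :
    rootProj P i x = x - (1 / 2 * P.toLinearMap x (P.coroot i)) • P.root i := by
  simp [rootProj, smul_smul]

lemma restrict_ι (i : ι) (x : M) :
    restrict P i (SymmetricAlgebra.ι ℚ M x) = SymmetricAlgebra.ι ℚ M (rootProj P i x) := by
  simp [restrict]

lemma restrict_rootElt_self (i : ι) : restrict P i (rootElt P i) = 0 := by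
  rw [rootElt, restrict_ι, rootProj_apply, root_coroot_eq_pairing, pairing_same]
  norm_num

lemma rootElt_dvd_sub_restrict (i : ι) (f : SymmetricAlgebra ℚ M) :
    rootElt P i ∣ f - restrict P i f := by
  induction f using SymmetricAlgebra.induction with
  | algebraMap r => simp
  | ι x =>
    rw [restrict_ι, rootProj_apply, map_sub, sub_sub_cancel, map_smul]
    exact dvd_smul_of_dvd _ (dvd_refl _)
  | mul a c ha hc =>
    have : a * c - restrict P i (a * c) =
        a * (c - restrict P i c) + (a - restrict P i a) * restrict P i c := by
      rw [map_mul]; ring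
    rw [this]
    exact dvd_add (hc.mul_left _) (ha.mul_right _)
  | add a c ha hc =>
    rw [map_add, add_sub_add_comm]
    exact dvd_add ha hc

/-- This identifies the multiples of a root with the kernel of an endomorphism of a domain, so a
root behaves as a prime element without any appeal to unique factorization. -/
lemma rootElt_dvd_iff {i : ι} {f : SymmetricAlgebra ℚ M} :
    rootElt P i ∣ f ↔ restrict P i f = 0 := by
  refine ⟨?_, fun h ↦ by simpa [h] using rootElt_dvd_sub_restrict (P := P) i f⟩
  rintro ⟨g, rfl⟩
  rw [map_mul, restrict_rootElt_self, zero_mul]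

variable [Fintype ι] [P.IsCrystallographic] [P.IsReduced] [P.IsRootSystem] {b : P.Base}

lemma restrict_rootElt_ne_zero {i j : ι} (hi : b.IsPos i) (hj : b.IsPos j) (hij : i ≠ j) :
    restrict P i (rootElt P j) ≠ 0 := by
  rw [rootElt, restrict_ι, Ne, map_eq_zero_iff _ (ι_injective P), rootProj_apply]
  intro h
  have hli := IsReduced.linearIndependent P hij fun h' : P.root i = -P.root j ↦ by
    have : i = P.reflectionPerm j j := by
      apply P.root.injective
      rw [root_reflectionPerm_self, h']
    rw [this, isPos_reflectionPerm_self_iff] at hi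
    exact hi hj
  rw [LinearIndependent.pair_iff] at hli
  have := hli (-(1 / 2 * P.toLinearMap (P.root j) (P.coroot i))) 1 (by rw [← h]; module)
  exact one_ne_zero this.2

lemma prod_rootElt_dvd {s : Finset ι} (hs : ∀ i ∈ s, b.IsPos i) {f : SymmetricAlgebra ℚ M}
    (hf : ∀ i ∈ s, rootElt P i ∣ f) : ∏ i ∈ s, rootElt P i ∣ f := by
  classical
  induction s using Finset.induction_on with
  | empty => simp
  | insert i s his ih =>
    obtain ⟨g, rfl⟩ := ih (fun j hj ↦ hs j (Finset.mem_insert_of_mem hj))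
      fun j hj ↦ hf j (Finset.mem_insert_of_mem hj)
    have h := hf i (Finset.mem_insert_self _ _)
    rw [rootElt_dvd_iff, map_mul, map_prod, mul_eq_zero] at h
    rw [Finset.prod_insert his, mul_comm]
    refine mul_dvd_mul_left _ (rootElt_dvd_iff.2 (h.resolve_left ?_))
    refine Finset.prod_ne_zero_iff.2 ?_
    intro j hj
    exact restrict_rootElt_ne_zero (hs i (Finset.mem_insert_self _ _))
      (hs j (Finset.mem_insert_of_mem hj)) (by rintro rfl; exact his hj)

end Divisibility

/-! ### Alternating sums -/

section AltSum

variable {P : RootPairing ι ℚ M N} (b : P.Base)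
variable [Fintype ι] [P.IsCrystallographic] [P.IsReduced] [P.IsRootSystem]

lemma altSum_add (f g : SymmetricAlgebra ℚ M) : altSum b (f + g) = altSum b f + altSum b g := by
  simp only [altSum, map_add, mul_add, Finset.sum_add_distrib]

lemma altSum_smul (c : ℚ) (f : SymmetricAlgebra ℚ M) : altSum b (c • f) = c • altSum b f := by
  simp only [altSum, map_smul, mul_smul_comm, Finset.smul_sum]

lemma altSum_mul_of_invariant {f : SymmetricAlgebra ℚ M} (hf : ∀ w : P.weylGroup, act P w f = f)
    (g : SymmetricAlgebra ℚ M) : altSum b (f * g) = f * altSum b g := by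
  simp only [altSum, map_mul, hf, Finset.mul_sum]
  exact Finset.sum_congr rfl fun w _ ↦ by ring

lemma neg_one_pow_length_mul_self (w : P.weylGroup) :
    (-1 : SymmetricAlgebra ℚ M) ^ length b w * (-1) ^ length b w = 1 := by
  rw [← pow_add, Even.neg_one_pow ⟨_, rfl⟩]

lemma act_altSum (w : P.weylGroup) (f : SymmetricAlgebra ℚ M) :
    act P w (altSum b f) = (-1) ^ length b w * altSum b f := by
  rw [altSum, map_sum, Finset.mul_sum]
  refine Fintype.sum_equiv (Equiv.mulLeft w) _ _ fun v ↦ ?_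
  rw [Equiv.coe_mulLeft, neg_one_pow_length_mul, act_mul, map_mul, map_pow, map_neg, map_one,
    ← mul_assoc, ← mul_assoc, neg_one_pow_length_mul_self, one_mul]

lemma altSum_act (w : P.weylGroup) (f : SymmetricAlgebra ℚ M) :
    altSum b (act P w f) = (-1) ^ length b w * altSum b f := by
  rw [altSum, altSum, Finset.mul_sum]
  refine Fintype.sum_equiv (Equiv.mulRight w) _ _ fun v ↦ ?_
  rw [Equiv.coe_mulRight, neg_one_pow_length_mul, act_mul, mul_right_comm, mul_left_comm,
    ← mul_assoc, mul_assoc, mul_comm ((-1) ^ length b w), neg_one_pow_length_mul_self]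
  ring

lemma altSum_eq_zero {i : ι} {f : SymmetricAlgebra ℚ M}
    (hf : act P (weylGroup.ofIdx P i) f = f) : altSum b f = 0 := by
  have h := altSum_act b (weylGroup.ofIdx P i) f
  rw [hf, neg_one_pow_length_ofIdx, neg_one_mul] at h
  rw [eq_neg_iff_add_eq_zero, ← two_smul ℚ (altSum b f)] at h
  exact (smul_eq_zero.1 h).resolve_left two_ne_zero

/-- An anti-invariant `g` satisfies `g = (g - σ g) / 2`, and the root divides `g - σ g`. -/
lemma rootElt_dvd_altSum (i : ι) (f : SymmetricAlgebra ℚ M) : rootElt P i ∣ altSum b f := by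
  have h := rootElt_dvd_sub P i (altSum b f)
  rw [act_altSum, neg_one_pow_length_ofIdx, neg_one_mul, sub_neg_eq_add, ← two_smul ℚ (altSum b f)] at h
  have := dvd_smul_of_dvd (1 / 2 : ℚ) h
  rwa [smul_smul, one_div, inv_mul_cancel₀ two_ne_zero, one_smul] at this

lemma posRootProd_dvd_altSum (f : SymmetricAlgebra ℚ M) : posRootProd b ∣ altSum b f :=
  prod_rootElt_dvd (fun _ hi ↦ mem_posRoots.1 hi) fun i _ ↦ rootElt_dvd_altSum b i f

lemma posRootProd_ne_zero : posRootProd b ≠ 0 :=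
  Finset.prod_ne_zero_iff.2 fun i _ ↦ rootElt_ne_zero i

lemma act_ofIdx_posRootProd (i : b.support) :
    act P (weylGroup.ofIdx P i) (posRootProd b) = -posRootProd b := by
  classical
  have hi : (i : ι) ∈ posRoots b := mem_posRoots.2 (Base.isPos_of_mem_support i.2)
  rw [posRootProd, ← Finset.mul_prod_erase _ _ hi, map_mul, map_prod, act_rootElt, perm_ofIdx,
    rootElt_reflectionPerm_self, neg_mul]
  congr 2
  have hmem : ∀ j ∈ (posRoots b).erase i, P.reflectionPerm i j ∈ (posRoots b).erase i := by
    intro j hj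
    rw [Finset.mem_erase, mem_posRoots] at hj ⊢
    refine ⟨fun h ↦ ?_, hj.2.reflectionPerm i.2 hj.1⟩
    rw [(P.reflectionPerm_involutive i).eq_iff] at h
    have h' := hj.2
    rw [h, isPos_reflectionPerm_self_iff] at h'
    exact h' (Base.isPos_of_mem_support i.2)
  refine Finset.prod_nbij' (P.reflectionPerm i) (P.reflectionPerm i) hmem hmem
    (fun _ _ ↦ P.reflectionPerm_self _ _) (fun _ _ ↦ P.reflectionPerm_self _ _) fun j _ ↦ ?_
  rw [act_rootElt, perm_ofIdx]

lemma act_posRootProd (w : P.weylGroup) :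
    act P w (posRootProd b) = (-1) ^ length b w * posRootProd b := by
  obtain ⟨l, rfl⟩ := exists_word b w
  rw [neg_one_pow_length_wordProd]
  induction l with
  | nil => simp [wordProd, act_one]
  | cons i l ih =>
    rw [wordProd_cons, act_mul, ih, map_mul, act_ofIdx_posRootProd, map_pow, map_neg, map_one,
      List.length_cons, pow_succ]
    ring

lemma altSum_posRootProd :
    altSum b (posRootProd b) = (Nat.card P.weylGroup : ℚ) • posRootProd b := by
  simp only [altSum, act_posRootProd, ← mul_assoc, neg_one_pow_length_mul_self, one_mul,
    Finset.sum_const, Finset.card_univ, Nat.card_eq_fintype_card]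
  rw [Nat.cast_smul_eq_nsmul]

lemma card_weylGroup_ne_zero : (Nat.card P.weylGroup : ℚ) ≠ 0 :=
  Nat.cast_ne_zero.2 Nat.card_pos.ne'

lemma altSum_topPoly : altSum b (topPoly b) = posRootProd b := by
  rw [topPoly, altSum_smul, altSum_posRootProd, smul_smul, one_div,
    inv_mul_cancel₀ (card_weylGroup_ne_zero), one_smul]

/-- The quotient of the alternating sum of `f` by the product of the positive roots. -/
def altQuot (f : SymmetricAlgebra ℚ M) : SymmetricAlgebra ℚ M :=
  (posRootProd_dvd_altSum b f).choose

variable {b}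

lemma altQuot_eq_iff {f q : SymmetricAlgebra ℚ M} :
    altQuot b f = q ↔ posRootProd b * q = altSum b f := by
  have h : altSum b f = posRootProd b * altQuot b f := (posRootProd_dvd_altSum b f).choose_spec
  rw [h, mul_right_inj' (posRootProd_ne_zero b), eq_comm]

lemma posRootProd_mul_altQuot (f : SymmetricAlgebra ℚ M) :
    posRootProd b * altQuot b f = altSum b f := altQuot_eq_iff.1 rfl

variable (b) in
/-- `altQuot` as a linear map. -/
def altQuotLin : SymmetricAlgebra ℚ M →ₗ[ℚ] SymmetricAlgebra ℚ M where
  toFun := altQuot b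
  map_add' f g := by
    rw [altQuot_eq_iff, mul_add, posRootProd_mul_altQuot, posRootProd_mul_altQuot, altSum_add]
  map_smul' c f := by
    rw [altQuot_eq_iff, mul_smul_comm, RingHom.id_apply, posRootProd_mul_altQuot, altSum_smul]

lemma altQuot_mul_of_invariant {f : SymmetricAlgebra ℚ M}
    (hf : ∀ w : P.weylGroup, act P w f = f) (g : SymmetricAlgebra ℚ M) :
    altQuot b (f * g) = f * altQuot b g := by
  rw [altQuot_eq_iff, mul_left_comm, posRootProd_mul_altQuot, altSum_mul_of_invariant b hf]

lemma act_altQuot (w : P.weylGroup) (f : SymmetricAlgebra ℚ M) :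
    act P w (altQuot b f) = altQuot b f := by
  have h := congrArg (act P w) (posRootProd_mul_altQuot (b := b) f)
  rw [map_mul, act_posRootProd, act_altSum, ← posRootProd_mul_altQuot, mul_assoc] at h
  have h1 : (-1 : SymmetricAlgebra ℚ M) ^ length b w ≠ 0 := pow_ne_zero _ (by simp)
  exact mul_left_cancel₀ (posRootProd_ne_zero b) (mul_left_cancel₀ h1 h)

lemma altQuot_topPoly : altQuot b (topPoly b) = 1 := by
  rw [altQuot_eq_iff, mul_one, altSum_topPoly]

/-- The image of a divided difference is fixed by its reflection, so the terms of the alternating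
sum cancel in pairs. -/
lemma altQuot_divDiff (i : ι) (f : SymmetricAlgebra ℚ M) : altQuot b (divDiff P i f) = 0 := by
  rw [altQuot_eq_iff, mul_zero, altSum_eq_zero b (act_divDiff i f)]

lemma topPoly_mem_degreeLE : topPoly b ∈ degreeLE M (posRoots b).card := by
  refine Submodule.smul_mem _ _ ?_
  rw [posRootProd]
  induction posRoots b using Finset.cons_induction with
  | empty => simpa using algebraMap_mem_degreeLE (M := M) 1
  | cons i s _ ih =>
    rw [Finset.prod_cons, Finset.card_cons, add_comm]
    exact mul_mem_degreeLE (ι_mem_degreeLE _) ih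

/-! ### The operator of the longest element -/

section Longest

variable {w₀ : P.weylGroup} (hw₀ : ∀ w : P.weylGroup, length b w ≤ length b w₀)
  {l : List b.support} (hl : IsReducedWord b w₀ l)
include hw₀ hl

lemma divDiffWord_longest_act (w : P.weylGroup) (f : SymmetricAlgebra ℚ M) :
    divDiffWord b l (act P w f) = (-1) ^ length b w * divDiffWord b l f := by
  obtain ⟨m, rfl⟩ := exists_word b w
  rw [neg_one_pow_length_wordProd]
  have step (i : b.support) (f : SymmetricAlgebra ℚ M) :
      divDiffWord b l (act P (weylGroup.ofIdx P i) f) = -divDiffWord b l f := by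
    -- Replace `l` by a reduced word of `w₀` ending in `i`, so that `A_i σ_i = -A_i` applies. Parity
    -- excludes that `w₀ σ_i` has the same length as `w₀`.
    obtain ⟨k, hk1, hk2⟩ := exists_isReducedWord b (w₀ * weylGroup.ofIdx P i)
    have h1 : wordProd b (k ++ [i]) = w₀ := by
      rw [wordProd_append, hk1, wordProd_cons]
      simp [wordProd, mul_assoc, ofIdx_mul_self]
    have h2 : length b (w₀ * weylGroup.ofIdx P i) < length b w₀ := by
      refine lt_of_le_of_ne (hw₀ _) fun h ↦ ?_
      have h3 := eq_longest_of_length_eq hw₀ h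
      have h4 := neg_one_pow_length_mul (b := b) (R := ℤ) w₀ (weylGroup.ofIdx P i)
      rw [neg_one_pow_length_ofIdx, h3] at h4
      have h5 : (-1 : ℤ) ^ length b w₀ ≠ 0 := pow_ne_zero _ (by simp)
      omega
    have h3 : IsReducedWord b w₀ (k ++ [i]) := by
      refine ⟨h1, le_antisymm ?_ ?_⟩
      · rw [List.length_append, hk2]; simpa using h2
      · conv_lhs => rw [← h1]
        exact length_wordProd_le b _
    rw [divDiffWord_congr hl h3, divDiffWord_congr hl h3, divDiffWord_append, divDiffWord_append,
      divDiffWord_cons, divDiffWord_cons]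
    change divDiffWord b k (divDiff P i (act P _ f)) = -divDiffWord b k (divDiff P i f)
    rw [divDiff_act, ← neg_one_smul ℚ, divDiffWord_smul, neg_one_smul]
  induction m with
  | nil => simp [wordProd, act_one]
  | cons i m ih =>
    rw [wordProd_cons, act_mul, step, ih, List.length_cons, pow_succ]
    ring

/-- Apply `A_{w₀}` to the alternating sum of `f` in two ways. By anti-symmetry of `A_{w₀}` the
result is `|W| A_{w₀} f`; by linearity over invariants it is `D(f)` times `|W| A_{w₀} P̃_{w₀}`,
where `A_{w₀} P̃_{w₀}` is constant for degree reasons. The value of `c` is not needed, only `c ≠ 0`.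
-/
lemma divDiffWord_longest_topPoly :
    ∃ c : ℚ, c ≠ 0 ∧ divDiffWord b l (topPoly b) = algebraMap ℚ _ c ∧
      ∀ f, divDiffWord b l f = c • altQuot b f := by
  obtain ⟨c, hc⟩ : ∃ c : ℚ, algebraMap ℚ _ c = divDiffWord b l (topPoly b) := by
    rw [← mem_degreeLE_zero]
    apply divDiffWord_mem_degreeLE
    rw [add_zero, hl.2, length_longest hw₀]
    exact topPoly_mem_degreeLE
  have key (f : SymmetricAlgebra ℚ M) : divDiffWord b l f = c • altQuot b f := by
    have h1 : divDiffWord b l (altSum b f) = (Nat.card P.weylGroup : ℚ) • divDiffWord b l f := by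
      have h2 (w : P.weylGroup) : divDiffWord b l ((-1) ^ length b w * act P w f) =
          divDiffWord b l f := by
        rw [divDiffWord_mul_of_invariant b l (by simp), divDiffWord_longest_act hw₀ hl,
          ← mul_assoc, neg_one_pow_length_mul_self, one_mul]
      change divDiffWordLin b l _ = _
      rw [altSum, map_sum]
      change ∑ w : P.weylGroup, divDiffWord b l ((-1) ^ length b w * act P w f) = _
      simp_rw [h2]
      rw [Finset.sum_const, Finset.card_univ, Nat.card_eq_fintype_card, Nat.cast_smul_eq_nsmul]
    have h3 : altSum b f = altQuot b f * ((Nat.card P.weylGroup : ℚ) • topPoly b) := by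
      rw [topPoly, smul_smul, mul_one_div_cancel card_weylGroup_ne_zero, one_smul, mul_comm,
        posRootProd_mul_altQuot]
    rw [h3, divDiffWord_mul_of_invariant b l (fun w ↦ act_altQuot w f), divDiffWord_smul, ← hc,
      mul_smul_comm] at h1
    rw [← smul_right_injective _ (card_weylGroup_ne_zero (P := P)) h1, Algebra.smul_def, mul_comm]
  refine ⟨c, ?_, hc.symm, key⟩
  rintro rfl
  obtain ⟨f, hf⟩ := exists_divDiffWord_ne_zero hl
  exact hf (by rw [key, zero_smul])

end Longest

end AltSum

/-! ### Schubert polynomials -/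

section Schubert

variable {P : RootPairing ι ℚ M N} {b : P.Base}
variable [Fintype ι] [P.IsCrystallographic] [P.IsReduced] [P.IsRootSystem]

variable (b) in
/-- The values at `0` of the polynomials `A_v f`. -/
def evalVec (word : P.weylGroup → List b.support) :
    SymmetricAlgebra ℚ M →ₗ[ℚ] (P.weylGroup → ℚ) :=
  LinearMap.pi fun v ↦ (evalAt P 0).toLinearMap ∘ₗ divDiffWordLin b (word v)

variable {word : P.weylGroup → List b.support}

lemma evalVec_apply (f : SymmetricAlgebra ℚ M) (v : P.weylGroup) :
    evalVec b word f v = evalAt P 0 (divDiffWord b (word v) f) := rfl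

section Word

variable (hword : ∀ w : P.weylGroup, IsReducedWord b w (word w))
include hword

lemma evalVec_eq_zero_iff {f : SymmetricAlgebra ℚ M} :
    evalVec b word f = 0 ↔ f ∈ coinvariantIdeal P := by
  refine ⟨fun h ↦ mem_coinvariantIdeal_of_forall_evalAt b fun l ↦ ?_, fun h ↦ funext fun v ↦
    evalAt_zero_of_mem_coinvariantIdeal (divDiffWord_mem_coinvariantIdeal b _ h)⟩
  rcases (length_wordProd_le b l).lt_or_eq with hl | hl
  · rw [divDiffWord_eq_zero hl, map_zero]
  · rw [divDiffWord_congr ⟨rfl, hl.symm⟩ (hword _)]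
    exact congrFun h (wordProd b l)

variable {w₀ : P.weylGroup} (hw₀ : ∀ w : P.weylGroup, length b w ≤ length b w₀)
include hw₀

lemma length_inv_mul_longest (w : P.weylGroup) :
    length b (w⁻¹ * w₀) + length b w = length b w₀ := by
  rw [← length_inv w, length_mul_longest hw₀]

/-- The concatenated word for `v w⁻¹ w₀` has length at least that of `w₀`, so it can be reduced only
if its product is `w₀`, that is, if `v = w`. -/
lemma divDiffWord_schubertPoly_eq_zero {v w : P.weylGroup} (h : length b w ≤ length b v)
    (hvw : v ≠ w) : divDiffWord b (word v) (schubertPoly b w₀ word w) = 0 := by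
  rw [schubertPoly, ← divDiffWord_append]
  apply divDiffWord_eq_zero
  rw [wordProd_append, List.length_append, (hword _).1, (hword _).1, (hword _).2, (hword _).2]
  have h1 := length_inv_mul_longest hword hw₀ w
  have h2 := hw₀ (v * (w⁻¹ * w₀))
  have h3 : length b (v * (w⁻¹ * w₀)) ≠ length b w₀ := fun h3 ↦ by
    have h4 := eq_longest_of_length_eq hw₀ h3
    rw [← mul_assoc, mul_eq_right, mul_inv_eq_one] at h4
    exact hvw h4
  omega

lemma divDiffWord_schubertPoly_self (w : P.weylGroup) :
    divDiffWord b (word w) (schubertPoly b w₀ word w) =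
      divDiffWord b (word w₀) (topPoly b) := by
  rw [schubertPoly, ← divDiffWord_append]
  refine divDiffWord_congr (w := w₀) ⟨?_, ?_⟩ (hword w₀) _
  · rw [wordProd_append, (hword _).1, (hword _).1, mul_inv_cancel_left]
  · rw [List.length_append, (hword _).2, (hword _).2, add_comm,
      length_inv_mul_longest hword hw₀]

lemma linearIndependent_evalVec_schubertPoly :
    LinearIndependent ℚ fun w ↦ evalVec b word (schubertPoly b w₀ word w) := by
  rw [Fintype.linearIndependent_iff]
  intro g hg
  by_contra! hne
  obtain ⟨w, hw⟩ := hne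
  -- At an index `v` of maximal length among the nonzero coefficients, triangularity kills every
  -- other term of the relation.
  obtain ⟨v, hv, hmax⟩ := Finset.exists_max_image (Finset.univ.filter fun w ↦ g w ≠ 0) (length b)
    ⟨w, by simpa using hw⟩
  rw [Finset.mem_filter] at hv
  have h := congrFun hg v
  rw [Finset.sum_apply, Finset.sum_eq_single v] at h
  · obtain ⟨c, hc0, hc, -⟩ := divDiffWord_longest_topPoly hw₀ (hword w₀)
    rw [Pi.smul_apply, evalVec_apply, divDiffWord_schubertPoly_self hword hw₀, hc,
      evalAt_algebraMap, smul_eq_mul, Pi.zero_apply, mul_eq_zero] at h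
    exact h.elim hv.2 hc0
  · intro u _ huv
    by_cases hu : g u = 0
    · rw [hu, zero_smul, Pi.zero_apply]
    · rw [Pi.smul_apply, evalVec_apply, divDiffWord_schubertPoly_eq_zero hword hw₀
        (hmax u (by simpa using hu)) huv.symm, map_zero, smul_zero]
  · simp

omit hword hw₀ in
lemma sum_schubertPoly_mk (g : P.weylGroup → ℚ) :
    ∑ w, g w • Ideal.Quotient.mk (coinvariantIdeal P) (schubertPoly b w₀ word w) =
      Ideal.Quotient.mk (coinvariantIdeal P) (∑ w, g w • schubertPoly b w₀ word w) := by
  change _ = (Ideal.Quotient.mkₐ ℚ (coinvariantIdeal P)).toLinearMap _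
  rw [map_sum]
  exact Finset.sum_congr rfl fun w _ ↦ (map_smul (Ideal.Quotient.mkₐ ℚ (coinvariantIdeal P)) _ _).symm

lemma linearIndependent_schubertPoly_mk : LinearIndependent ℚ fun w ↦
    Ideal.Quotient.mk (coinvariantIdeal P) (schubertPoly b w₀ word w) := by
  have h := linearIndependent_evalVec_schubertPoly hword hw₀
  rw [Fintype.linearIndependent_iff] at h ⊢
  intro g hg
  refine h g ?_
  rw [sum_schubertPoly_mk, Ideal.Quotient.eq_zero_iff_mem,
    ← evalVec_eq_zero_iff hword] at hg
  simpa using hg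

lemma exists_sub_sum_schubertPoly_mem (f : SymmetricAlgebra ℚ M) :
    ∃ g : P.weylGroup → ℚ, f - ∑ w, g w • schubertPoly b w₀ word w ∈ coinvariantIdeal P := by
  -- There are as many vectors as coordinates, so independence already gives spanning.
  have h := (linearIndependent_evalVec_schubertPoly hword hw₀).span_eq_top_of_card_eq_finrank
    (by simp)
  have hf : evalVec b word f ∈ Submodule.span ℚ
      (Set.range fun w ↦ evalVec b word (schubertPoly b w₀ word w)) := h ▸ Submodule.mem_top
  obtain ⟨g, hg⟩ := (Submodule.mem_span_range_iff_exists_fun ℚ).1 hf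
  refine ⟨g, (evalVec_eq_zero_iff hword).1 ?_⟩
  rw [map_sub, ← hg, map_sum]
  simp

variable (b word w₀) in
/-- The basis of the coinvariant algebra given by the classes of the Schubert polynomials. -/
def schubertBasis : Module.Basis P.weylGroup ℚ (CoinvariantAlgebra P) :=
  Module.Basis.mk (linearIndependent_schubertPoly_mk hword hw₀) <| by
    rintro x -
    obtain ⟨f, rfl⟩ := Ideal.Quotient.mk_surjective x
    obtain ⟨g, hg⟩ := exists_sub_sum_schubertPoly_mem hword hw₀ f
    rw [← Ideal.Quotient.eq] at hg
    rw [hg, ← sum_schubertPoly_mk]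
    exact Submodule.sum_mem _ fun w _ ↦
      Submodule.smul_mem _ _ (Submodule.subset_span ⟨w, rfl⟩)

lemma schubertBasis_apply (w : P.weylGroup) : schubertBasis b word hword w₀ hw₀ w =
    Ideal.Quotient.mk (coinvariantIdeal P) (schubertPoly b w₀ word w) := by
  rw [schubertBasis, Module.Basis.mk_apply]

omit hw₀ in
lemma altQuot_schubertPoly_longest : altQuot b (schubertPoly b w₀ word w₀) = 1 := by
  have h : word (w₀⁻¹ * w₀) = [] := by
    rw [← List.length_eq_zero_iff, (hword _).2, inv_mul_cancel, length_one]
  rw [schubertPoly, h]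
  exact altQuot_topPoly

omit hw₀ in
lemma altQuot_schubertPoly_of_ne {w : P.weylGroup} (hw : w ≠ w₀) :
    altQuot b (schubertPoly b w₀ word w) = 0 := by
  rw [schubertPoly]
  rcases h : word (w⁻¹ * w₀) with - | ⟨i, l⟩
  · have h1 := (hword (w⁻¹ * w₀)).1
    rw [h] at h1
    exact absurd (inv_mul_eq_one.1 h1.symm) hw
  · rw [divDiffWord_cons, altQuot_divDiff]

lemma evalAt_zero_altQuot_eq_repr (f : SymmetricAlgebra ℚ M) :
    evalAt P 0 (altQuot b f) = (schubertBasis b word hword w₀ hw₀).repr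
      (Ideal.Quotient.mk (coinvariantIdeal P) f) w₀ := by
  obtain ⟨g, hg⟩ := exists_sub_sum_schubertPoly_mem hword hw₀ f
  have h1 : evalAt P 0 (altQuotLin b (f - ∑ w, g w • schubertPoly b w₀ word w)) = 0 :=
    evalAt_zero_of_mem_coinvariantIdeal
      (map_mem_coinvariantIdeal (altQuotLin b) (fun _ hf g ↦ altQuot_mul_of_invariant hf g) hg)
  rw [map_sub, map_sum, map_sub, sub_eq_zero] at h1
  have h2 : ∑ w, altQuotLin b (g w • schubertPoly b w₀ word w) =
      algebraMap ℚ (SymmetricAlgebra ℚ M) (g w₀) := by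
    rw [Finset.sum_eq_single w₀]
    · rw [map_smul]
      change g w₀ • altQuot b _ = _
      rw [altQuot_schubertPoly_longest hword, Algebra.smul_def, mul_one]
    · intro w _ hw
      rw [map_smul]
      change g w • altQuot b _ = _
      rw [altQuot_schubertPoly_of_ne hword hw, smul_zero]
    · simp
  rw [h2, evalAt_algebraMap] at h1
  rw [← Ideal.Quotient.eq] at hg
  rw [hg, ← sum_schubertPoly_mk]
  simp_rw [← schubertBasis_apply hword hw₀]
  rw [Module.Basis.repr_sum_self]
  exact h1

end Word

/-- Up to the nonzero factor `c`, `D` is a composite of `|Φ⁺|` divided differences, each lowering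
the degree by one. -/
lemma altQuot_mem_degreeLE_zero {w₀ : P.weylGroup}
    (hw₀ : ∀ w : P.weylGroup, length b w ≤ length b w₀) {f : SymmetricAlgebra ℚ M}
    (hf : f ∈ degreeLE M (posRoots b).card) : altQuot b f ∈ degreeLE M 0 := by
  obtain ⟨l, hl⟩ := exists_isReducedWord b w₀
  obtain ⟨c, hc0, -, hc⟩ := divDiffWord_longest_topPoly hw₀ hl
  rw [← length_longest hw₀, ← hl.2, ← add_zero l.length] at hf
  have h := divDiffWord_mem_degreeLE b l hf
  rwa [hc, Submodule.smul_mem_iff _ hc0] at h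

end Schubert

end BGG

end

theorem proposition4p3 {ι M N : Type*} [Fintype ι] [AddCommGroup M] [Module ℚ M]
    [AddCommGroup N] [Module ℚ N] (P : RootPairing ι ℚ M N) [P.IsRootSystem]
    [P.IsCrystallographic] [P.IsReduced] (b : P.Base)
    (w₀ : P.weylGroup) (hw₀ : ∀ w : P.weylGroup, BGG.length b w ≤ BGG.length b w₀)
    (word : P.weylGroup → List b.support)
    (hword : ∀ w : P.weylGroup, BGG.IsReducedWord b w (word w)) :
    ∃ (D : SymmetricAlgebra ℚ M →ₗ[ℚ] SymmetricAlgebra ℚ M) (Ψ : SymmetricAlgebra ℚ M →ₗ[ℚ] ℚ),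
      -- `D f` is the one and only polynomial `(1 / ∏ α) * ∑_σ (-1)^{ℓ(σ)} σ(f)`
      (∀ f q : SymmetricAlgebra ℚ M, BGG.posRootProd b * q = BGG.altSum b f ↔ q = D f) ∧
      (∀ f : SymmetricAlgebra ℚ M, Ψ f = BGG.evalAt P 0 (D f)) ∧
      -- the classes `P_w` form a basis of `R / J`, and `Ψ` is the coefficient of `P_{w₀}`
      (∃ B : Module.Basis P.weylGroup ℚ (BGG.CoinvariantAlgebra P),
        (∀ w : P.weylGroup, B w =
          Ideal.Quotient.mk (BGG.coinvariantIdeal P) (BGG.schubertPoly b w₀ word w)) ∧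
        ∀ f : SymmetricAlgebra ℚ M,
          Ψ f = B.repr (Ideal.Quotient.mk (BGG.coinvariantIdeal P) f) w₀) ∧
      -- in degree at most `|Φ⁺|` one may evaluate anywhere
      (∀ f ∈ BGG.degreeLE M (BGG.posRoots b).card, ∀ h : N, Ψ f = BGG.evalAt P h (D f)) := by
  refine ⟨BGG.altQuotLin b, (BGG.evalAt P 0).toLinearMap ∘ₗ BGG.altQuotLin b,
    fun f q ↦ BGG.altQuot_eq_iff.symm.trans eq_comm, fun f ↦ rfl,
    ⟨BGG.schubertBasis b word hword w₀ hw₀, BGG.schubertBasis_apply hword hw₀,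
      BGG.evalAt_zero_altQuot_eq_repr hword hw₀⟩, fun f hf h ↦ ?_⟩
  obtain ⟨c, hc⟩ := BGG.mem_degreeLE_zero.1 (BGG.altQuot_mem_degreeLE_zero hw₀ hf)
  change BGG.evalAt P 0 (BGG.altQuot b f) = BGG.evalAt P h (BGG.altQuot b f)
  rw [← hc, BGG.evalAt_algebraMap, BGG.evalAt_algebraMap]
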